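/- There is a function $c:(0,\infty)^3\to(0,\infty)$ such that the following holds. Let $d\ge 0$, $N,P\ge 1$ be integers, $\lambda>0$ and $\gamma=P/N$. Let $K:\mathbb R^d\times\mathbb R^d\to\mathbb R$ be a symmetric kernel with positive semidefinite Gram matrices, and let $X=(x_1,\dots,x_N)$ be points of $\mathbb R^d$ whose Gram matrix $K(X,X)=(K(x_i,x_j))_{i,j}$ is positive definite (this holds for all distinct $x_1,\dots,x_N$ if $K$ is strictly positive definite). Let $d_1,\dots,d_N$ be the eigenvalues of $K(X,X)$, $T=\frac1N\mathrm{Tr}\,K(X,X)$, $y\in\mathbb R^N$ and $\|y\|_{K^{-1}}=\sqrt{y^TK(X,X)^{-1}y}$. Let $f^{(1)},\dots,f^{(P)}$ be independent centered Gaussian processes on $\mathbb R^d$ with covariance $K$, let $F=\big(\tfrac1{\sqrt P}f^{(j)}(x_i)\big)_{i,j}\in\mathbb R^{N\times P}$, let $\hat\theta=F^T(FF^T+\lambda I_N)^{-1}y$ (the unique minimizer of $\theta\mapsto\frac1N\|F\theta-y\|^2+\frac{\lambda}{N}\|\theta\|^2$), and define the $\lambda$-random-feature (RF) predictor $\hat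 f^{(RF)}_{\lambda,\gamma}(x)=\frac1{\sqrt P}\sum_{j=1}^P\hat\theta_jf^{(j)}(x)$ and, for $t>0$, the kernel ridge regression (KRR) predictor $\hat f^{(K)}_t(x)=K(x,X)(K(X,X)+tI_N)^{-1}y$. Then the equation $$\tilde\lambda=\lambda+\frac{\tilde\lambda}{\gamma}\,\frac1N\sum_{i=1}^N\frac{d_i}{\tilde\lambda+d_i}$$ has a unique positive solution $\tilde\lambda$; it satisfies $\tilde\lambda>\lambda$; and with $c=c(\lambda,\gamma,T)$ the random variable $\hat f^{(RF)}_{\lambda,\gamma}(x)$ is integrable and $$\left|\mathbb E[\hat f^{(RF)}_{\lambda,\gamma}(x)]-\hat f^{(K)}_{\tilde\lambda}(x)\right|\le\frac{c\sqrt{K(x,x)}\,\|y\|_{K^{-1}}}{P}\qquad\text{for all }x\in\mathbb R^d.$$ Moreover, let $\mathcal D$ be a probability measure on $\mathbb R^d$, let $f^*:\mathbb R^d\to\mathbb R$ satisfy $\mathbb E_{\mathcal D}[f^*(x)^2]<\infty$, let $L(g)=\mathbb E_{\mathcal D}[(g(x)-f^*(x))^2]$, and suppose that $K$ is measurable and $\mathbb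 E_{\mathcal D}[K(x,x)]<\infty$. Then $L(\mathbb E[\hat f^{(RF)}_{\lambda,\gamma}])$ and $L(\hat f^{(K)}_{\tilde\lambda})$ are finite and, with the same constant $c$ and $C=c\sqrt{\mathbb E_{\mathcal D}[K(x,x)]}$, $$\left|L\big(\mathbb E[\hat f^{(RF)}_{\lambda,\gamma}]\big)-L\big(\hat f^{(K)}_{\tilde\lambda}\big)\right|\le\frac{C\|y\|_{K^{-1}}}{P}\left(2\sqrt{L\big(\hat f^{(K)}_{\tilde\lambda}\big)}+\frac{C\|y\|_{K^{-1}}}{P}\right).$$ -/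

import Mathlib

open MeasureTheory ProbabilityTheory
open scoped Matrix

noncomputable section

namespace RandomFeatures

/-- The data space `ℝᵈ`. -/
abbrev Pt (d : ℕ) : Type := EuclideanSpace ℝ (Fin d)

/-! ### Linear models and ridge regression -/

/-- The linear model `f_θ = P^{-1/2} ∑ⱼ θⱼ φ⁽ʲ⁾`. -/
def linModel {d P : ℕ} (φ : Fin P → Pt d → ℝ) (θ : Fin P → ℝ) (x : Pt d) : ℝ :=
  (1 / √(P : ℝ)) * ∑ j, θ j * φ j x

/-- The regularized mean square error
`(1/N) ∑ᵢ (f_θ(xᵢ) - yᵢ)² + (λ/N) ‖θ‖²`. -/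
def ridgeLoss {d N P : ℕ} (φ : Fin P → Pt d → ℝ) (X : Fin N → Pt d) (y : Fin N → ℝ)
    (lam : ℝ) (θ : Fin P → ℝ) : ℝ :=
  (1 / (N : ℝ)) * ∑ i, (linModel φ θ (X i) - y i) ^ 2 + (lam / N) * ∑ j, θ j ^ 2

/-- The data matrix `F`, with entries `F i j = P^{-1/2} φ⁽ʲ⁾(xᵢ)`. -/
def dataMatrix {d N P : ℕ} (φ : Fin P → Pt d → ℝ) (X : Fin N → Pt d) :
    Matrix (Fin N) (Fin P) ℝ :=
  Matrix.of fun i j => (1 / √(P : ℝ)) * φ j (X i)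

/-- The optimal parameter `θ̂ = Fᵀ (F Fᵀ + λ I)⁻¹ y`; it is the unique minimizer of `ridgeLoss`,
see `ridgeLoss_thetaHat_lt`. -/
def thetaHat {d N P : ℕ} (φ : Fin P → Pt d → ℝ) (X : Fin N → Pt d) (y : Fin N → ℝ)
    (lam : ℝ) : Fin P → ℝ :=
  (dataMatrix φ X)ᵀ *ᵥ
    ((dataMatrix φ X * (dataMatrix φ X)ᵀ + lam • (1 : Matrix (Fin N) (Fin N) ℝ))⁻¹ *ᵥ y)

theorem ridgeLoss_thetaHat_lt {d N P : ℕ} (hN : 0 < N) (φ : Fin P → Pt d → ℝ)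
    (X : Fin N → Pt d) (y : Fin N → ℝ) {lam : ℝ} (hlam : 0 < lam) (θ : Fin P → ℝ)
    (hθ : θ ≠ thetaHat φ X y lam) :
    ridgeLoss φ X y lam (thetaHat φ X y lam) < ridgeLoss φ X y lam θ := by
  set F := dataMatrix φ X with hF
  set S := F * Fᵀ + lam • (1 : Matrix (Fin N) (Fin N) ℝ) with hS
  set v := S⁻¹ *ᵥ y with hv
  set t := thetaHat φ X y lam with ht
  have htv : t = Fᵀ *ᵥ v := rfl
  have hSpos : S.PosDef := by
    have h1 : (F * Fᵀ).PosSemidef := by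
      simpa using Matrix.posSemidef_self_mul_conjTranspose F
    exact Matrix.PosDef.posSemidef_add h1 (Matrix.PosDef.one.smul hlam)
  have hSv : S *ᵥ v = y := by
    rw [hv, Matrix.mulVec_mulVec,
      Matrix.mul_nonsing_inv _ ((Matrix.isUnit_iff_isUnit_det _).1 hSpos.isUnit),
      Matrix.one_mulVec]
  have hres : F *ᵥ t - y = -(lam • v) := by
    have : S *ᵥ v = F *ᵥ t + lam • v := by
      rw [htv, Matrix.mulVec_mulVec v, hS, Matrix.add_mulVec, Matrix.smul_mulVec,
        Matrix.one_mulVec]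
    rw [hSv] at this
    rw [this]; abel
  have hmodel : ∀ (η : Fin P → ℝ) (i : Fin N), linModel φ η (X i) = (F *ᵥ η) i := by
    intro η i
    simp only [linModel, hF, dataMatrix, Matrix.mulVec, dotProduct, Matrix.of_apply, Finset.mul_sum]
    exact Finset.sum_congr rfl fun j _ => by ring
  have hloss : ∀ η : Fin P → ℝ, ridgeLoss φ X y lam η =
      (1 / (N : ℝ)) * ((F *ᵥ η - y) ⬝ᵥ (F *ᵥ η - y) + lam * (η ⬝ᵥ η)) := by
    intro η
    simp only [ridgeLoss, hmodel, dotProduct, Pi.sub_apply, pow_two]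
    ring
  have he : 0 < (θ - t) ⬝ᵥ (θ - t) := by
    have h0 : 0 ≤ (θ - t) ⬝ᵥ (θ - t) := Finset.sum_nonneg fun i _ => mul_self_nonneg _
    exact lt_of_le_of_ne h0 fun h => hθ (sub_eq_zero.1 (dotProduct_self_eq_zero.1 h.symm))
  have hFe : 0 ≤ (F *ᵥ (θ - t)) ⬝ᵥ (F *ᵥ (θ - t)) :=
    Finset.sum_nonneg fun i _ => mul_self_nonneg _
  have hcross : (F *ᵥ (θ - t)) ⬝ᵥ v = (θ - t) ⬝ᵥ t := by
    have h := Matrix.dotProduct_mulVec (θ - t) Fᵀ v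
    rw [Matrix.vecMul_transpose] at h
    rw [← h, ← htv]
  have hθe : θ = t + (θ - t) := by abel
  have hFθ : F *ᵥ θ - y = F *ᵥ (θ - t) + -(lam • v) := by
    rw [← hres, Matrix.mulVec_sub]; abel
  rw [hloss, hloss]
  have hNpos : (0 : ℝ) < 1 / (N : ℝ) := by positivity
  refine mul_lt_mul_of_pos_left ?_ hNpos
  have h1 : (F *ᵥ θ - y) ⬝ᵥ (F *ᵥ θ - y) = (F *ᵥ (θ - t)) ⬝ᵥ (F *ᵥ (θ - t))
      - 2 * lam * ((θ - t) ⬝ᵥ t) + (F *ᵥ t - y) ⬝ᵥ (F *ᵥ t - y) := by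
    rw [hFθ, hres, ← hcross]
    simp only [add_dotProduct, dotProduct_add, neg_dotProduct, dotProduct_neg, smul_dotProduct,
      dotProduct_smul, smul_eq_mul, dotProduct_comm v]
    ring
  have h2 : θ ⬝ᵥ θ = t ⬝ᵥ t + 2 * ((θ - t) ⬝ᵥ t) + (θ - t) ⬝ᵥ (θ - t) := by
    simp only [sub_dotProduct, dotProduct_sub, dotProduct_comm t θ]
    ring
  rw [h1, h2]
  nlinarith [mul_pos hlam he]

/-! ### Kernels, Gaussian random features and predictors -/

/-- The Gram matrix `K(X, X)`, with entries `K(xᵢ, xⱼ)`. -/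
def gram {d N : ℕ} (K : Pt d → Pt d → ℝ) (X : Fin N → Pt d) : Matrix (Fin N) (Fin N) ℝ :=
  Matrix.of fun i j => K (X i) (X j)

/-- `K` is a symmetric kernel all of whose Gram matrices are positive semidefinite. -/
structure IsKernel {d : ℕ} (K : Pt d → Pt d → ℝ) : Prop where
  symm : ∀ x x', K x x' = K x' x
  posSemidef : ∀ (n : ℕ) (X : Fin n → Pt d), (gram K X).PosSemidef

/-- `f⁽¹⁾, …, f⁽ᴾ⁾` are independent centered Gaussian processes on `ℝᵈ` with covariance `K`
(hence identically distributed). -/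
structure IsGaussianFeatures {d P : ℕ} (K : Pt d → Pt d → ℝ) {Ω : Type*} [MeasurableSpace Ω]
    (μ : Measure Ω) (f : Fin P → Pt d → Ω → ℝ) : Prop where
  measurable : ∀ j x, Measurable (f j x)
  gaussian : ∀ j, IsGaussianProcess (f j) μ
  mean : ∀ j x, ∫ ω, f j x ω ∂μ = 0
  cov : ∀ j x x', ∫ ω, f j x ω * f j x' ω ∂μ = K x x'
  indep : iIndepFun (fun (j : Fin P) (ω : Ω) (x : Pt d) => f j x ω) μ

/-- The random feature predictor with ridge `λ`, at the sample point `ω` and the input `x`. -/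
def rfPredictor {d N P : ℕ} {Ω : Type*} (f : Fin P → Pt d → Ω → ℝ) (X : Fin N → Pt d)
    (y : Fin N → ℝ) (lam : ℝ) (ω : Ω) (x : Pt d) : ℝ :=
  linModel (fun j z => f j z ω) (thetaHat (fun j z => f j z ω) X y lam) x

/-- The average random feature predictor `x ↦ 𝔼[f̂_λ(x)]`. -/
def avgRFPredictor {d N P : ℕ} {Ω : Type*} [MeasurableSpace Ω] (μ : Measure Ω)
    (f : Fin P → Pt d → Ω → ℝ) (X : Fin N → Pt d) (y : Fin N → ℝ) (lam : ℝ) (x : Pt d) : ℝ :=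
  ∫ ω, rfPredictor f X y lam ω x ∂μ

/-- The kernel ridge regression predictor `x ↦ K(x, X) (K(X, X) + λ I)⁻¹ y`. -/
def krrPredictor {d N : ℕ} (K : Pt d → Pt d → ℝ) (X : Fin N → Pt d) (y : Fin N → ℝ)
    (lam : ℝ) (x : Pt d) : ℝ :=
  (fun i => K x (X i)) ⬝ᵥ ((gram K X + lam • (1 : Matrix (Fin N) (Fin N) ℝ))⁻¹ *ᵥ y)

/-- The inverse kernel norm `‖y‖_{K⁻¹} = (yᵀ K(X, X)⁻¹ y)^{1/2}` of the labels. -/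
def invKernelNorm {d N : ℕ} (K : Pt d → Pt d → ℝ) (X : Fin N → Pt d) (y : Fin N → ℝ) : ℝ :=
  √(y ⬝ᵥ ((gram K X)⁻¹ *ᵥ y))

/-- `t` is a positive solution of the effective ridge equation
`t = λ + (t / γ) (1/N) ∑ᵢ dᵢ / (t + dᵢ)`, the `dᵢ` being the eigenvalues of the Gram matrix `G`. -/
def IsEffectiveRidge {N : ℕ} {G : Matrix (Fin N) (Fin N) ℝ} (hG : G.IsHermitian)
    (lam γ t : ℝ) : Prop :=
  0 < t ∧ t = lam + t / γ * ((1 / (N : ℝ)) * ∑ i, hG.eigenvalues i / (t + hG.eigenvalues i))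

/-- The risk (test MSE) `L(g) = 𝔼_𝒟[(g(x) - f*(x))²]`. -/
def risk {d : ℕ} (D : Measure (Pt d)) (fstar g : Pt d → ℝ) : ℝ :=
  ∫ x, (g x - fstar x) ^ 2 ∂D

end RandomFeatures

end

/-! Let `d_k` be the eigenvalues of the Gram matrix. Given the feature values at the data points,
each `f⁽ʲ⁾(x)` is its linear regression on those values plus an independent centered residual. Since
`θ̂` depends only on the data values, the averaged predictor at `x` is the regression of its values
at the data points (`IsGaussianFeatures.avgRFPredictor_eq_sum`). In an eigenbasis of the Gram matrix
the data matrix becomes an `N × P` array of independent standard Gaussians with rows `w_k` scaled by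
`√(d_k / P)`. With the resolvent `R = (λ + ∑ (d_k / P) w_k w_kᵀ)⁻¹`, the fitted values involve only
the numbers `w_k · R w_l`. Flipping the sign of one row kills the expectation for `k ≠ l`, so
everything reduces to comparing `a_k = 𝔼[(d_k / P) w_k · R w_k]` with the ridge regression
coefficient `d_k / (λ̃ + d_k)`.

Leaving row `k` out (Sherman–Morrison) gives `(d_k / P) w_k · R w_k = d_k g_k / (1 + d_k g_k)`,
where `g_k` is the leave-one-out quadratic form divided by `P`. With `τ = tr R / P`, the trace of
`R⁻¹ R = 1` reads `λ τ + (1/P) ∑ d_k g_k / (1 + d_k g_k) = 1`, and `m = 1 / λ̃` solves the same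
equation with `τ` and all `g_k` replaced by `m`. The variance of a Gaussian quadratic form makes
`g_k - τ` of order `P^{-1/2}` in `L²`, and monotonicity of the equation transfers this to `τ - m`.
The rate for expectations is better: the first order fluctuation of `g_k` has mean zero, deleting a
row moves `τ` by at most `1 / (λ P)`, and the Taylor remainder is quadratic. Taking expectations in
the equation then bounds the bias by `O(1/P)` (`integral_satur_sub_le`).

A Cauchy–Schwarz inequality weighted by the `d_k` turns the coefficient error into the pointwise
bound (`abs_avgRFPredictor_sub_krrPredictor_le`), and expanding a square gives the risk bound
(`abs_integral_sq_sub_le`). -/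

namespace RandomFeatures

/-! ### Inverses of symmetric matrices bounded below by `λ I`, and rank-one perturbations. -/

section Coercive

variable {n : Type*} [Fintype n] [DecidableEq n] {lam : ℝ} {B : Matrix n n ℝ}

omit [DecidableEq n] in
theorem posDef_of_coercive (hlam : 0 < lam) (hs : B.IsSymm)
    (hB : ∀ v, lam * (v ⬝ᵥ v) ≤ v ⬝ᵥ B *ᵥ v) : B.PosDef := by
  refine Matrix.PosDef.of_dotProduct_mulVec_pos (by simpa [Matrix.IsHermitian] using hs.eq) fun v hv => ?_
  have h0 : 0 < v ⬝ᵥ v :=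
    lt_of_le_of_ne (Finset.sum_nonneg fun i _ => mul_self_nonneg _)
      fun h => hv (dotProduct_self_eq_zero.1 h.symm)
  simpa using lt_of_lt_of_le (mul_pos hlam h0) (hB v)

theorem mul_inv_of_coercive (hlam : 0 < lam) (hs : B.IsSymm)
    (hB : ∀ v, lam * (v ⬝ᵥ v) ≤ v ⬝ᵥ B *ᵥ v) : B * B⁻¹ = 1 :=
  Matrix.mul_nonsing_inv _
    ((Matrix.isUnit_iff_isUnit_det _).1 (posDef_of_coercive hlam hs hB).isUnit)

theorem mulVec_inv_mulVec_of_coercive (hlam : 0 < lam) (hs : B.IsSymm)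
    (hB : ∀ v, lam * (v ⬝ᵥ v) ≤ v ⬝ᵥ B *ᵥ v) (v : n → ℝ) : B *ᵥ (B⁻¹ *ᵥ v) = v := by
  rw [Matrix.mulVec_mulVec, mul_inv_of_coercive hlam hs hB, Matrix.one_mulVec]

theorem inv_mulVec_mulVec_of_coercive (hlam : 0 < lam) (hs : B.IsSymm)
    (hB : ∀ v, lam * (v ⬝ᵥ v) ≤ v ⬝ᵥ B *ᵥ v) (v : n → ℝ) : B⁻¹ *ᵥ (B *ᵥ v) = v := by
  rw [Matrix.mulVec_mulVec, mul_eq_one_comm.1 (mul_inv_of_coercive hlam hs hB),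
    Matrix.one_mulVec]

theorem isSymm_inv (hs : B.IsSymm) : (B⁻¹).IsSymm := by
  unfold Matrix.IsSymm
  rw [Matrix.transpose_nonsing_inv, hs.eq]

theorem lam_mul_norm_inv_le (hlam : 0 < lam) (hs : B.IsSymm)
    (hB : ∀ v, lam * (v ⬝ᵥ v) ≤ v ⬝ᵥ B *ᵥ v) (v : n → ℝ) :
    lam * ((B⁻¹ *ᵥ v) ⬝ᵥ (B⁻¹ *ᵥ v)) ≤ v ⬝ᵥ B⁻¹ *ᵥ v := by
  have h := hB (B⁻¹ *ᵥ v)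
  rwa [mulVec_inv_mulVec_of_coercive hlam hs hB, dotProduct_comm _ v] at h

theorem quad_inv_nonneg (hlam : 0 < lam) (hs : B.IsSymm)
    (hB : ∀ v, lam * (v ⬝ᵥ v) ≤ v ⬝ᵥ B *ᵥ v) (v : n → ℝ) : 0 ≤ v ⬝ᵥ B⁻¹ *ᵥ v :=
  le_trans (mul_nonneg hlam.le (Finset.sum_nonneg fun _ _ => mul_self_nonneg _))
    (lam_mul_norm_inv_le hlam hs hB v)

/-- With `u = B⁻¹ v`, coercivity at `u` gives `λ ‖u‖² ≤ v · u`; insert this in `0 ≤ ‖v - λ u‖²`. -/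
theorem norm_inv_mulVec_le (hlam : 0 < lam) (hs : B.IsSymm)
    (hB : ∀ v, lam * (v ⬝ᵥ v) ≤ v ⬝ᵥ B *ᵥ v) (v : n → ℝ) :
    (B⁻¹ *ᵥ v) ⬝ᵥ (B⁻¹ *ᵥ v) ≤ (1 / lam ^ 2) * (v ⬝ᵥ v) := by
  have h := lam_mul_norm_inv_le hlam hs hB v
  set u := B⁻¹ *ᵥ v
  have h1 : 0 ≤ (v - lam • u) ⬝ᵥ (v - lam • u) := Finset.sum_nonneg fun _ _ => mul_self_nonneg _
  have h2 : (v - lam • u) ⬝ᵥ (v - lam • u) = v ⬝ᵥ v - 2 * lam * (v ⬝ᵥ u) + lam ^ 2 * (u ⬝ᵥ u) := by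
    simp only [sub_dotProduct, dotProduct_sub, smul_dotProduct, dotProduct_smul, smul_eq_mul,
      dotProduct_comm u v]
    ring
  rw [div_mul_eq_mul_div, one_mul, le_div_iff₀ (by positivity)]
  nlinarith [mul_le_mul_of_nonneg_left h hlam.le]

theorem sum_sq_inv_col_le (hlam : 0 < lam) (hs : B.IsSymm)
    (hB : ∀ v, lam * (v ⬝ᵥ v) ≤ v ⬝ᵥ B *ᵥ v) (b : n) :
    ∑ a, (B⁻¹ a b) ^ 2 ≤ 1 / lam ^ 2 := by
  have h := norm_inv_mulVec_le hlam hs hB (Pi.single b 1)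
  simpa [dotProduct, pow_two, Matrix.col, Pi.single_apply] using h

/-- A squared Frobenius norm linear in the dimension: this is what makes the variance of the
normalized quadratic forms of order `1/P`. -/
theorem sum_sq_inv_le (hlam : 0 < lam) (hs : B.IsSymm)
    (hB : ∀ v, lam * (v ⬝ᵥ v) ≤ v ⬝ᵥ B *ᵥ v) :
    ∑ a, ∑ b, (B⁻¹ a b) ^ 2 ≤ Fintype.card n / lam ^ 2 := by
  rw [Finset.sum_comm]
  refine (Finset.sum_le_sum fun b _ => sum_sq_inv_col_le hlam hs hB b).trans_eq ?_
  simp [div_eq_mul_inv]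

theorem abs_inv_apply_le (hlam : 0 < lam) (hs : B.IsSymm)
    (hB : ∀ v, lam * (v ⬝ᵥ v) ≤ v ⬝ᵥ B *ᵥ v) (a b : n) : |B⁻¹ a b| ≤ 1 / lam := by
  refine abs_le_of_sq_le_sq ?_ (by positivity)
  calc (B⁻¹ a b) ^ 2 ≤ ∑ a, (B⁻¹ a b) ^ 2 :=
        Finset.single_le_sum (f := fun a => (B⁻¹ a b) ^ 2) (fun _ _ => sq_nonneg _)
          (Finset.mem_univ a)
    _ ≤ 1 / lam ^ 2 := sum_sq_inv_col_le hlam hs hB b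
    _ = (1 / lam) ^ 2 := by rw [div_pow, one_pow]

variable {B' : Matrix n n ℝ} {c : ℝ} {w : n → ℝ}

/-- Sherman–Morrison: `B` maps `B'⁻¹ w` to a multiple of `w`, the factor being `1 + c (w · B'⁻¹ w)`.
-/
theorem inv_mulVec_rank_one (hlam : 0 < lam) (hs : B.IsSymm)
    (hB : ∀ v, lam * (v ⬝ᵥ v) ≤ v ⬝ᵥ B *ᵥ v) (hs' : B'.IsSymm)
    (hB' : ∀ v, lam * (v ⬝ᵥ v) ≤ v ⬝ᵥ B' *ᵥ v) (hc : 0 ≤ c)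
    (h : B = B' + c • Matrix.vecMulVec w w) :
    B⁻¹ *ᵥ w = (1 + c * (w ⬝ᵥ B'⁻¹ *ᵥ w))⁻¹ • (B'⁻¹ *ᵥ w) := by
  have hpos : 0 < 1 + c * (w ⬝ᵥ B'⁻¹ *ᵥ w) := by
    have := mul_nonneg hc (quad_inv_nonneg hlam hs' hB' w); linarith
  have h1 : B *ᵥ (B'⁻¹ *ᵥ w) = (1 + c * (w ⬝ᵥ B'⁻¹ *ᵥ w)) • w := by
    rw [h, Matrix.add_mulVec, mulVec_inv_mulVec_of_coercive hlam hs' hB', Matrix.smul_mulVec,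
      Matrix.vecMulVec_mulVec, add_smul, one_smul, mul_smul]
    simp
  have h2 : B'⁻¹ *ᵥ w = (1 + c * (w ⬝ᵥ B'⁻¹ *ᵥ w)) • (B⁻¹ *ᵥ w) := by
    rw [← Matrix.mulVec_smul, ← h1, inv_mulVec_mulVec_of_coercive hlam hs hB]
  rw [h2, smul_smul, ← h2, inv_mul_cancel₀ hpos.ne', one_smul]

theorem quad_inv_rank_one (hlam : 0 < lam) (hs : B.IsSymm)
    (hB : ∀ v, lam * (v ⬝ᵥ v) ≤ v ⬝ᵥ B *ᵥ v) (hs' : B'.IsSymm)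
    (hB' : ∀ v, lam * (v ⬝ᵥ v) ≤ v ⬝ᵥ B' *ᵥ v) (hc : 0 ≤ c)
    (h : B = B' + c • Matrix.vecMulVec w w) :
    c * (w ⬝ᵥ B⁻¹ *ᵥ w) = c * (w ⬝ᵥ B'⁻¹ *ᵥ w) / (1 + c * (w ⬝ᵥ B'⁻¹ *ᵥ w)) := by
  rw [inv_mulVec_rank_one hlam hs hB hs' hB' hc h, dotProduct_smul, smul_eq_mul]
  ring

/-- By the resolvent identity the difference of the inverses has rank one. With `u = B'⁻¹ w` and `q
= w · u` its trace is `c ‖u‖² / (1 + c q)`, and `λ ‖u‖² ≤ q`. The bound depends neither on `c` and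
`w` nor on the dimension. -/
theorem abs_trace_inv_rank_one_le (hlam : 0 < lam) (hs : B.IsSymm)
    (hB : ∀ v, lam * (v ⬝ᵥ v) ≤ v ⬝ᵥ B *ᵥ v) (hs' : B'.IsSymm)
    (hB' : ∀ v, lam * (v ⬝ᵥ v) ≤ v ⬝ᵥ B' *ᵥ v) (hc : 0 ≤ c)
    (h : B = B' + c • Matrix.vecMulVec w w) :
    |B'⁻¹.trace - B⁻¹.trace| ≤ 1 / lam := by
  have hq := quad_inv_nonneg hlam hs' hB' w
  have hn := lam_mul_norm_inv_le hlam hs' hB' w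
  have hv := inv_mulVec_rank_one hlam hs hB hs' hB' hc h
  set q := w ⬝ᵥ B'⁻¹ *ᵥ w
  set u := B'⁻¹ *ᵥ w with hu
  have hpos : 0 < 1 + c * q := by have := mul_nonneg hc hq; linarith
  have hd : B'⁻¹ - B⁻¹ = c • Matrix.vecMulVec (B'⁻¹ *ᵥ w) (B⁻¹ *ᵥ w) := by
    have e1 : B'⁻¹ - B⁻¹ = B'⁻¹ * (B - B') * B⁻¹ := by
      rw [mul_sub, sub_mul, mul_eq_one_comm.1 (mul_inv_of_coercive hlam hs' hB'), one_mul,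
        mul_assoc, mul_inv_of_coercive hlam hs hB, mul_one]
    have e2 : B - B' = c • Matrix.vecMulVec w w := by rw [h]; abel
    have e3 : w ᵥ* B⁻¹ = B⁻¹ *ᵥ w := by
      rw [← Matrix.mulVec_transpose, (isSymm_inv hs).eq]
    rw [e1, e2, Matrix.mul_smul, Matrix.smul_mul, Matrix.mul_vecMulVec, Matrix.vecMulVec_mul, e3]
  have ht : B'⁻¹.trace - B⁻¹.trace = c * ((1 + c * q)⁻¹ * (u ⬝ᵥ u)) := by
    rw [← Matrix.trace_sub, hd, hv, Matrix.trace_smul, Matrix.trace_vecMulVec, ← hu,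
      dotProduct_smul, smul_eq_mul, smul_eq_mul]
  have huu : 0 ≤ u ⬝ᵥ u := Finset.sum_nonneg fun _ _ => mul_self_nonneg _
  rw [ht, abs_of_nonneg (by positivity)]
  have : c * ((1 + c * q)⁻¹ * (u ⬝ᵥ u)) = c * (u ⬝ᵥ u) / (1 + c * q) := by ring
  rw [this, div_le_div_iff₀ hpos hlam]
  nlinarith [mul_le_mul_of_nonneg_left hn hc]

end Coercive

/-! ### Regularized second moment matrices and their resolvents. -/

/-- The regularized second moment matrix `λ I + ∑ₖ cₖ wₖ wₖᵀ`. -/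
noncomputable def regMoment {ι n : Type*} [Fintype ι] [DecidableEq n] (lam : ℝ) (c : ι → ℝ)
    (w : ι → n → ℝ) : Matrix n n ℝ :=
  lam • (1 : Matrix n n ℝ) + ∑ k, c k • Matrix.vecMulVec (w k) (w k)

section RegMoment

variable {ι n : Type*} [Fintype ι] [Fintype n] [DecidableEq n] {lam : ℝ} {c : ι → ℝ}

omit [Fintype n] in
theorem regMoment_isSymm (w : ι → n → ℝ) : (regMoment lam c w).IsSymm := by
  ext a b
  simp [regMoment, Matrix.sum_apply, Matrix.vecMulVec_apply, Matrix.one_apply, eq_comm, mul_comm]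

theorem regMoment_mulVec (w : ι → n → ℝ) (v : n → ℝ) :
    regMoment lam c w *ᵥ v = lam • v + ∑ k, (c k * (w k ⬝ᵥ v)) • w k := by
  rw [regMoment, Matrix.add_mulVec, Matrix.smul_mulVec, Matrix.one_mulVec, Matrix.sum_mulVec]
  congr 1
  refine Finset.sum_congr rfl fun k _ => ?_
  rw [Matrix.smul_mulVec, Matrix.vecMulVec_mulVec, mul_smul]
  simp

theorem regMoment_coercive (hc : ∀ k, 0 ≤ c k) (w : ι → n → ℝ) (v : n → ℝ) :
    lam * (v ⬝ᵥ v) ≤ v ⬝ᵥ regMoment lam c w *ᵥ v := by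
  rw [regMoment_mulVec, dotProduct_add, dotProduct_smul, smul_eq_mul, dotProduct_sum]
  refine le_add_of_nonneg_right (Finset.sum_nonneg fun k _ => ?_)
  rw [dotProduct_smul, smul_eq_mul, dotProduct_comm v, mul_assoc]
  exact mul_nonneg (hc k) (mul_self_nonneg _)

-- Setting the weight `c k` to zero is how a row is left out: the index set stays the same, so the
-- reduced matrix is again a `regMoment` of the same family.
omit [Fintype n] in
theorem regMoment_update [DecidableEq ι] (w : ι → n → ℝ) (k : ι) :
    regMoment lam c w =
      regMoment lam (Function.update c k 0) w + c k • Matrix.vecMulVec (w k) (w k) := by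
  rw [regMoment, regMoment, add_assoc, ← Finset.sum_erase_add _ _ (Finset.mem_univ k),
    ← Finset.sum_erase_add (f := fun i => Function.update c k 0 i • Matrix.vecMulVec (w i) (w i))
      (h := Finset.mem_univ k)]
  rw [Function.update_self, zero_smul, add_zero]
  refine congrArg₂ _ rfl (congrArg₂ _ ?_ rfl)
  refine Finset.sum_congr rfl fun i hi => ?_
  rw [Function.update_of_ne (Finset.ne_of_mem_erase hi)]

omit [Fintype ι] in
theorem update_zero_nonneg [DecidableEq ι] (hc : ∀ k, 0 ≤ c k) (k i : ι) :
    0 ≤ Function.update c k 0 i := by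
  by_cases h : i = k
  · subst h; simp
  · simpa [Function.update_of_ne h] using hc i

/-- The trace of `B * B⁻¹ = 1`, expanded along the definition of `B`. -/
theorem trace_resolvent_identity (hlam : 0 < lam) (hc : ∀ k, 0 ≤ c k) (w : ι → n → ℝ) :
    lam * ((regMoment lam c w)⁻¹).trace + ∑ k, c k * (w k ⬝ᵥ (regMoment lam c w)⁻¹ *ᵥ w k)
      = Fintype.card n := by
  have h := mul_inv_of_coercive hlam (regMoment_isSymm w) (regMoment_coercive hc w)
  have h2 := congrArg Matrix.trace h
  rw [Matrix.trace_one] at h2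
  rw [← h2]
  have hR := (isSymm_inv (regMoment_isSymm (lam := lam) (c := c) w)).eq
  set R := (regMoment lam c w)⁻¹
  rw [regMoment, Matrix.add_mul, Matrix.trace_add, Matrix.smul_mul, Matrix.one_mul,
    Matrix.trace_smul, smul_eq_mul, Matrix.sum_mul, Matrix.trace_sum]
  refine congrArg₂ (· + ·) rfl (Finset.sum_congr rfl fun k _ => ?_)
  rw [Matrix.smul_mul, Matrix.trace_smul, Matrix.vecMulVec_mul, Matrix.trace_vecMulVec, smul_eq_mul,
    ← Matrix.mulVec_transpose, hR, dotProduct_comm]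

/-- Cramer's formula; coercivity keeps the determinant positive. -/
theorem continuous_resolvent_apply (hlam : 0 < lam) (hc : ∀ k, 0 ≤ c k) (a b : n) :
    Continuous fun w : ι → n → ℝ => (regMoment lam c w)⁻¹ a b := by
  have h0 : Continuous fun w : ι → n → ℝ => regMoment lam c w := by
    refine continuous_matrix fun i j => ?_
    simp only [regMoment, Matrix.add_apply, Matrix.smul_apply, Matrix.sum_apply,
      Matrix.vecMulVec_apply]
    fun_prop
  simp only [Matrix.inv_def, Ring.inverse_eq_inv', Matrix.smul_apply, smul_eq_mul]
  refine Continuous.mul (Continuous.inv₀ h0.matrix_det fun w => ?_)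
    (h0.matrix_adjugate.matrix_elem a b)
  exact (posDef_of_coercive hlam (regMoment_isSymm w) (regMoment_coercive hc w)).det_pos.ne'

end RegMoment

/-! ### Moments, symmetries and independence for the standard Gaussian vector. -/

section StdGaussian

variable {ι : Type*} [Fintype ι]

/-- The standard Gaussian measure on `ι → ℝ`. -/
noncomputable def stdGaussianPi (ι : Type*) [Fintype ι] : Measure (ι → ℝ) :=
  Measure.pi fun _ : ι => gaussianReal 0 1

instance : IsProbabilityMeasure (stdGaussianPi ι) := by
  unfold stdGaussianPi; infer_instance

theorem measurePreserving_eval_stdGaussianPi (i : ι) :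
    MeasurePreserving (fun x : ι → ℝ => x i) (stdGaussianPi ι) (gaussianReal 0 1) :=
  measurePreserving_eval (fun _ : ι => gaussianReal 0 1) i

theorem memLp_eval_stdGaussianPi (i : ι) {p : ENNReal} (hp : p ≠ ⊤) :
    MemLp (fun x : ι → ℝ => x i) p (stdGaussianPi ι) :=
  (memLp_id_gaussianReal' (μ := 0) (v := 1) p hp).comp_measurePreserving
    (measurePreserving_eval_stdGaussianPi i)

theorem integral_eval_stdGaussianPi (i : ι) {f : ℝ → ℝ} (hf : Measurable f) :
    ∫ x : ι → ℝ, f (x i) ∂stdGaussianPi ι = ∫ t, f t ∂gaussianReal 0 1 := by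
  rw [← (measurePreserving_eval_stdGaussianPi i).map_eq,
    integral_map (measurable_pi_apply i).aemeasurable hf.aestronglyMeasurable]

theorem iIndepFun_stdGaussianPi :
    iIndepFun (fun (i : ι) (x : ι → ℝ) => x i) (stdGaussianPi ι) :=
  iIndepFun_pi (μ := fun _ : ι => gaussianReal 0 1) (X := fun _ => id)
    (fun _ => aemeasurable_id)

/-- The coordinatewise sign flip of the coordinates in `s`. -/
def signFlip [DecidableEq ι] (s : Finset ι) (x : ι → ℝ) : ι → ℝ :=
  fun i => if i ∈ s then -x i else x i

theorem measurePreserving_signFlip [DecidableEq ι] (s : Finset ι) :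
    MeasurePreserving (signFlip s) (stdGaussianPi ι) (stdGaussianPi ι) := by
  refine measurePreserving_pi (fun _ : ι => gaussianReal 0 1) (fun _ : ι => gaussianReal 0 1)
    (f := fun i x => if i ∈ s then -x else x) fun i => ?_
  by_cases h : i ∈ s
  · simp only [h, if_true]
    exact ⟨measurable_neg, by simpa using gaussianReal_map_neg (μ := 0) (v := 1)⟩
  · simp only [h, if_false]
    exact MeasurePreserving.id _

theorem measurableEmbedding_signFlip [DecidableEq ι] (s : Finset ι) :
    MeasurableEmbedding (signFlip s : (ι → ℝ) → ι → ℝ) := by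
  have hinv : Function.Involutive (signFlip s : (ι → ℝ) → ι → ℝ) := fun x => by
    ext i; by_cases h : i ∈ s <;> simp [signFlip, h]
  exact (MeasurableEquiv.ofInvolutive _ hinv (measurePreserving_signFlip s).measurable).measurableEmbedding

theorem integral_eq_zero_of_signFlip [DecidableEq ι] (s : Finset ι) {f : (ι → ℝ) → ℝ}
    (hf : ∀ x, f (signFlip s x) = -f x) : ∫ x, f x ∂stdGaussianPi ι = 0 := by
  have h := (measurePreserving_signFlip s).integral_comp (measurableEmbedding_signFlip s) f
  simp only [hf, integral_neg] at h
  linarith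

theorem integral_sq_gaussianReal : ∫ x, x ^ 2 ∂gaussianReal 0 1 = 1 := by
  have h := variance_fun_id_gaussianReal (μ := 0) (v := 1)
  rw [variance_of_integral_eq_zero (by fun_prop) (by simp)] at h
  simpa using h

theorem integral_mul_stdGaussianPi [DecidableEq ι] (a b : ι) :
    ∫ x : ι → ℝ, x a * x b ∂stdGaussianPi ι = if a = b then 1 else 0 := by
  split_ifs with h
  · subst h
    simp only [← pow_two]
    rw [integral_eval_stdGaussianPi a (f := fun t => t ^ 2) (by fun_prop),
      integral_sq_gaussianReal]
  · refine integral_eq_zero_of_signFlip {a} fun x => ?_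
    simp [signFlip, Ne.symm h]

theorem integral_sq_mul_sq_stdGaussianPi {a b : ι} (h : a ≠ b) :
    ∫ x : ι → ℝ, x a ^ 2 * x b ^ 2 ∂stdGaussianPi ι = 1 := by
  classical
  have hi := (iIndepFun_stdGaussianPi (ι := ι)).indepFun h
  have hi2 := hi.comp (φ := fun t => t ^ 2) (ψ := fun t => t ^ 2) (by fun_prop) (by fun_prop)
  have h1 := hi2.integral_fun_mul_eq_mul_integral
    ((measurable_pi_apply a).pow_const 2).aestronglyMeasurable
    ((measurable_pi_apply b).pow_const 2).aestronglyMeasurable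
  have h2 : ∀ i : ι, ∫ x : ι → ℝ, x i ^ 2 ∂stdGaussianPi ι = 1 := fun i => by
    simpa [pow_two] using integral_mul_stdGaussianPi i i
  simpa [Function.comp_def, h2] using h1

theorem integrable_prod_four_stdGaussianPi (a b c d : ι) :
    Integrable (fun x : ι → ℝ => x a * x b * (x c * x d)) (stdGaussianPi ι) := by
  have h : ∀ i j : ι, MemLp (fun x : ι → ℝ => x i * x j) 2 (stdGaussianPi ι) := fun i j => by
    have : ENNReal.HolderTriple 4 4 2 := ⟨by
      rw [← two_mul, show (4 : ENNReal) = 2 * 2 by norm_num,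
        ENNReal.mul_inv (by simp) (by simp), ← mul_assoc, ENNReal.mul_inv_cancel (by simp) (by simp),
        one_mul]⟩
    exact (memLp_eval_stdGaussianPi j (p := 4) (by simp)).mul'
      (memLp_eval_stdGaussianPi i (p := 4) (by simp))
  exact (h a b).integrable_mul (h c d)

/-- The fourth derivative at `0` of the moment generating function `exp (t² / 2)`. Each
differentiation replaces the polynomial factor `p` by `p' + t p`, giving `1, t, 1 + t², 3t + t³, 3 +
6t² + t⁴`. -/
theorem integral_pow_four_gaussianReal : ∫ x, x ^ 4 ∂gaussianReal 0 1 = 3 := by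
  have hd : ∀ p q : ℝ → ℝ, (∀ t, HasDerivAt p (q t - t * p t) t) →
      deriv (fun t => p t * Real.exp (t ^ 2 / 2)) = fun t => q t * Real.exp (t ^ 2 / 2) := by
    intro p q h
    ext t
    have h1 : HasDerivAt (fun t : ℝ => t ^ 2 / 2) t t := by
      simpa using (hasDerivAt_pow 2 t).div_const 2
    exact ((h t).mul h1.exp).deriv.trans (by ring)
  have hpoly : ∀ (n : ℕ) (t : ℝ), HasDerivAt (fun s : ℝ => s ^ n) (n * t ^ (n - 1)) t :=
    fun n t => hasDerivAt_pow n t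
  have h := iteratedDeriv_mgf_zero (X := fun x => x) (μ := gaussianReal 0 1) (by simp) 4
  have h0 : mgf (fun x => x) (gaussianReal 0 1) = fun t => (1 : ℝ) * Real.exp (t ^ 2 / 2) := by
    rw [mgf_fun_id_gaussianReal]; simp
  rw [h0, iteratedDeriv_succ, iteratedDeriv_succ, iteratedDeriv_succ, iteratedDeriv_one,
    hd (fun _ => 1) (fun t => t) fun t => by simpa using hasDerivAt_const t (1 : ℝ),
    hd (fun t => t) (fun t => 1 + t ^ 2) fun t => 
      (hasDerivAt_id' t).congr_deriv (by ring),
    hd (fun t => 1 + t ^ 2) (fun t => 3 * t + t ^ 3) fun t => 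
      ((hpoly 2 t).const_add 1).congr_deriv (by push_cast; ring),
    hd (fun t => 3 * t + t ^ 3) (fun t => 3 + 6 * t ^ 2 + t ^ 4) fun t => 
      (((hasDerivAt_id' t).const_mul 3).add (hpoly 3 t)).congr_deriv (by push_cast; ring)] at h
  simpa using h.symm

/-- Isserlis' formula. If some index occurs an odd number of times, flipping the sign of that
coordinate makes the integral vanish; otherwise the monomial is `x_a⁴` or `x_a² x_b²`. -/
theorem integral_prod_four_stdGaussianPi [DecidableEq ι] (a b c d : ι) :
    ∫ x : ι → ℝ, x a * x b * (x c * x d) ∂stdGaussianPi ι =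
      (if a = b then 1 else 0) * (if c = d then 1 else 0)
      + (if a = c then 1 else 0) * (if b = d then 1 else 0)
      + (if a = d then 1 else 0) * (if b = c then 1 else 0) := by
  have key : ∀ i j : ι, i ≠ j → ∫ x : ι → ℝ, x i ^ 2 * x j ^ 2 ∂stdGaussianPi ι = 1 :=
    fun i j h => integral_sq_mul_sq_stdGaussianPi h
  by_cases hab : a = b
  · subst hab
    by_cases hcd : c = d
    · subst hcd
      by_cases hac : a = c
      · subst hac
        have : ∀ x : ι → ℝ, x a * x a * (x a * x a) = (x a) ^ 4 := fun x => by ring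
        simp only [this, if_true]
        rw [integral_eval_stdGaussianPi a (f := fun t => t ^ 4) (by fun_prop),
          integral_pow_four_gaussianReal]
        norm_num
      · have : ∀ x : ι → ℝ, x a * x a * (x c * x c) = x a ^ 2 * x c ^ 2 := fun x => by ring
        simp [this, key a c hac, hac]
    · by_cases hac : a = c
      · subst hac
        rw [integral_eq_zero_of_signFlip {d} fun x => by simp [signFlip, hcd]]
        simp [hcd]
      · rw [integral_eq_zero_of_signFlip {c} fun x => by simp [signFlip, hac, Ne.symm hcd]]
        simp [hcd, hac]
  · by_cases hac : a = c
    · subst hac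
      by_cases hbd : b = d
      · subst hbd
        have : ∀ x : ι → ℝ, x a * x b * (x a * x b) = x a ^ 2 * x b ^ 2 := fun x => by ring
        simp [this, key a b hab, hab]
      · rw [integral_eq_zero_of_signFlip {b} fun x => by
          simp [signFlip, hab, Ne.symm hbd]]
        simp [hab, hbd, Ne.symm hab]
    · by_cases had : a = d
      · subst had
        by_cases hbc : b = c
        · subst hbc
          have : ∀ x : ι → ℝ, x a * x b * (x b * x a) = x a ^ 2 * x b ^ 2 := fun x => by ring
          simp [this, key a b hab, hab]
        · rw [integral_eq_zero_of_signFlip {b} fun x => by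
            simp [signFlip, hab, Ne.symm hbc]]
          simp [hab, hac, hbc]
      · rw [integral_eq_zero_of_signFlip {a} fun x => by
          simp [signFlip, Ne.symm hab, Ne.symm hac, Ne.symm had]]
        simp [hab, hac, had]

theorem indepFun_of_dependsOn [DecidableEq ι] {s t : Finset ι} (hst : Disjoint s t)
    {φ ψ : (ι → ℝ) → ℝ} (hφ : Measurable φ) (hψ : Measurable ψ)
    (hφs : DependsOn φ (s : Set ι)) (hψt : DependsOn ψ (t : Set ι)) :
    IndepFun φ ψ (stdGaussianPi ι) := by
  have hfac : ∀ (s : Finset ι) (φ : (ι → ℝ) → ℝ), Measurable φ → DependsOn φ (s : Set ι) →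
      ∃ φ' : (s → ℝ) → ℝ, Measurable φ' ∧ φ = φ' ∘ fun x i => x i := by
    intro s φ hφ hφs
    -- Extension by zero outside `s` is harmless, since `φ` ignores those coordinates.
    refine ⟨fun u => φ fun i => if h : i ∈ s then u ⟨i, h⟩ else 0, hφ.comp ?_, ?_⟩
    · refine measurable_pi_lambda _ fun i => ?_
      by_cases h : i ∈ s <;> simp only [h, dite_true, dite_false] <;> fun_prop
    · ext x
      exact hφs fun i hi => by simp [Finset.mem_coe.1 hi]
  obtain ⟨φ', hφ', rfl⟩ := hfac s φ hφ hφs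
  obtain ⟨ψ', hψ', rfl⟩ := hfac t ψ hψ hψt
  exact ((iIndepFun_stdGaussianPi (ι := ι)).indepFun_finset s t hst
    fun i => measurable_pi_apply i).comp hφ' hψ'

/-! ### Centered quadratic forms in a block of Gaussian coordinates, with a matrix independent of
that block. -/

variable {n : Type*} [Fintype n] [DecidableEq n] [DecidableEq ι] {e : n → ι}
  {M : (ι → ℝ) → Matrix n n ℝ} {C : ℝ}

omit [DecidableEq ι] in
theorem integrable_mul_of_bounded {φ ψ : (ι → ℝ) → ℝ} (hφ : Measurable φ) (hC : ∀ x, |φ x| ≤ C)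
    (hψ : Integrable ψ (stdGaussianPi ι)) :
    Integrable (fun x => φ x * ψ x) (stdGaussianPi ι) :=
  hψ.bdd_mul hφ.aestronglyMeasurable (Filter.Eventually.of_forall hC)

omit [DecidableEq ι] in
theorem integrable_prod_two_stdGaussianPi (a b : ι) :
    Integrable (fun x : ι → ℝ => x a * x b) (stdGaussianPi ι) :=
  (memLp_eval_stdGaussianPi a (p := 2) (by simp)).integrable_mul
    (memLp_eval_stdGaussianPi b (p := 2) (by simp))

/-- The centered quadratic form `∑ M_ab (z_a z_b - δ_ab)`. -/
noncomputable def centeredQuad (e : n → ι) (M : (ι → ℝ) → Matrix n n ℝ) (x : ι → ℝ) : ℝ :=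
  ∑ a, ∑ b, M x a b * (x (e a) * x (e b) - if a = b then 1 else 0)

omit [Fintype n] [DecidableEq ι] in
theorem integrable_centered_prod (a b : n) : Integrable
    (fun x : ι → ℝ => x (e a) * x (e b) - if a = b then 1 else 0) (stdGaussianPi ι) :=
  (integrable_prod_two_stdGaussianPi _ _).sub (integrable_const _)

omit [DecidableEq ι] in
theorem integrable_centeredQuad (hM : ∀ a b, Measurable fun x => M x a b)
    (hC : ∀ x a b, |M x a b| ≤ C) : Integrable (centeredQuad e M) (stdGaussianPi ι) :=
  integrable_finsetSum _ fun a _ => integrable_finsetSum _ fun b _ =>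
    integrable_mul_of_bounded (hM a b) (hC · a b) (integrable_centered_prod a b)

theorem integral_centeredQuad (he : Function.Injective e)
    (hM : ∀ a b, Measurable fun x => M x a b) (hC : ∀ x a b, |M x a b| ≤ C)
    (hdep : DependsOn M ((Finset.univ.image e)ᶜ : Finset ι)) :
    ∫ x, centeredQuad e M x ∂stdGaussianPi ι = 0 := by
  have hi := fun a b => integrable_mul_of_bounded (hM a b) (hC · a b)
    (integrable_centered_prod (e := e) a b)
  simp only [centeredQuad]
  rw [integral_finsetSum _ fun a _ => integrable_finsetSum _ fun b _ => hi a b]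
  refine Finset.sum_eq_zero fun a _ => ?_
  rw [integral_finsetSum _ fun b _ => hi a b]
  refine Finset.sum_eq_zero fun b _ => ?_
  have hind := indepFun_of_dependsOn (disjoint_compl_left (a := Finset.univ.image e))
    (φ := fun x => M x a b)
    (ψ := fun x => x (e a) * x (e b) - if a = b then 1 else 0) (hM a b) (by fun_prop)
    (fun x y h => by simp only [hdep h]) (fun x y h => by
      simp only [h (e a) (by simp), h (e b) (by simp)])
  rw [hind.integral_fun_mul_eq_mul_integral (hM a b).aestronglyMeasurable (by fun_prop),
    integral_sub (integrable_prod_two_stdGaussianPi _ _) (integrable_const _),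
    integral_mul_stdGaussianPi]
  simp [he.eq_iff]

-- Centering removes the pairing `(ab)(cd)` from Isserlis' formula; the two crossed pairings remain.
omit [Fintype n] in
theorem integral_centered_prod_mul (he : Function.Injective e) (a b c d : n) :
    ∫ x : ι → ℝ, (x (e a) * x (e b) - if a = b then 1 else 0)
        * (x (e c) * x (e d) - if c = d then 1 else 0) ∂stdGaussianPi ι
      = (if a = c then 1 else 0) * (if b = d then 1 else 0)
        + (if a = d then 1 else 0) * (if b = c then 1 else 0) := by
  have h : ∀ x : ι → ℝ, (x (e a) * x (e b) - if a = b then 1 else 0)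
        * (x (e c) * x (e d) - if c = d then 1 else 0)
      = x (e a) * x (e b) * (x (e c) * x (e d)) - (if c = d then 1 else 0) * (x (e a) * x (e b))
        - (if a = b then 1 else 0) * (x (e c) * x (e d))
        + (if a = b then 1 else 0) * (if c = d then 1 else 0) := fun x => by ring
  simp only [h]
  have i4 := integrable_prod_four_stdGaussianPi (e a) (e b) (e c) (e d)
  have i2 := fun (i j : n) (t : ℝ) =>
    (integrable_prod_two_stdGaussianPi (e i) (e j)).const_mul t
  rw [integral_add (by exact (i4.sub (i2 a b _)).sub (i2 c d _)) (integrable_const _),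
    integral_sub (by exact i4.sub (i2 a b _)) (i2 c d _), integral_sub i4 (i2 a b _),
    integral_const_mul, integral_const_mul, integral_prod_four_stdGaussianPi,
    integral_mul_stdGaussianPi, integral_mul_stdGaussianPi]
  simp only [he.eq_iff, integral_const, probReal_univ, one_smul]
  ring

omit [Fintype n] [DecidableEq ι] in
theorem integrable_centered_prod_mul (a b c d : n) :
    Integrable (fun x : ι → ℝ => (x (e a) * x (e b) - if a = b then 1 else 0)
        * (x (e c) * x (e d) - if c = d then 1 else 0)) (stdGaussianPi ι) := by
  have h : ∀ x : ι → ℝ, (x (e a) * x (e b) - if a = b then 1 else 0)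
        * (x (e c) * x (e d) - if c = d then 1 else 0)
      = x (e a) * x (e b) * (x (e c) * x (e d)) - (if c = d then 1 else 0) * (x (e a) * x (e b))
        - (if a = b then 1 else 0) * (x (e c) * x (e d))
        + (if a = b then 1 else 0) * (if c = d then 1 else 0) := fun x => by ring
  simp only [h]
  have i4 := integrable_prod_four_stdGaussianPi (e a) (e b) (e c) (e d)
  have i2 := fun (i j : n) (t : ℝ) =>
    (integrable_prod_two_stdGaussianPi (e i) (e j)).const_mul t
  exact ((i4.sub (i2 a b _)).sub (i2 c d _)).add (integrable_const _)

omit [Fintype ι] [DecidableEq ι] in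
theorem centeredQuad_sq (x : ι → ℝ) : centeredQuad e M x ^ 2 =
    ∑ a, ∑ b, ∑ c, ∑ d, M x a b * M x c d *
      ((x (e a) * x (e b) - if a = b then 1 else 0)
        * (x (e c) * x (e d) - if c = d then 1 else 0)) := by
  rw [pow_two, centeredQuad, Finset.sum_mul]
  refine Finset.sum_congr rfl fun a _ => ?_
  rw [Finset.sum_mul]
  refine Finset.sum_congr rfl fun b _ => ?_
  rw [Finset.mul_sum]
  refine Finset.sum_congr rfl fun c _ => ?_
  rw [Finset.mul_sum]
  exact Finset.sum_congr rfl fun d _ => by ring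

omit [Fintype n] [DecidableEq ι] in
theorem integrable_centeredQuad_term (hM : ∀ a b, Measurable fun x => M x a b)
    (hC : ∀ x a b, |M x a b| ≤ C) (a b c d : n) :
    Integrable (fun x => M x a b * M x c d *
      ((x (e a) * x (e b) - if a = b then 1 else 0)
        * (x (e c) * x (e d) - if c = d then 1 else 0))) (stdGaussianPi ι) :=
  integrable_mul_of_bounded (C := C * C) ((hM a b).mul (hM c d))
    (fun x => by
      rw [abs_mul]
      exact mul_le_mul (hC x a b) (hC x c d) (abs_nonneg _) ((abs_nonneg _).trans (hC x a b)))
    (integrable_centered_prod_mul a b c d)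

omit [DecidableEq ι] in
theorem integrable_centeredQuad_sq (hM : ∀ a b, Measurable fun x => M x a b)
    (hC : ∀ x a b, |M x a b| ≤ C) :
    Integrable (fun x => centeredQuad e M x ^ 2) (stdGaussianPi ι) := by
  simp only [centeredQuad_sq]
  exact integrable_finsetSum _ fun a _ => integrable_finsetSum _ fun b _ =>
    integrable_finsetSum _ fun c _ => integrable_finsetSum _ fun d _ =>
      integrable_centeredQuad_term hM hC a b c d

/-- The matrix is independent of the block, so each term factors. The two crossed pairings
contribute equally because `M` is symmetric, whence the factor `2`. -/
theorem integral_centeredQuad_sq (he : Function.Injective e)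
    (hM : ∀ a b, Measurable fun x => M x a b) (hC : ∀ x a b, |M x a b| ≤ C)
    (hs : ∀ x, (M x).IsSymm)
    (hdep : DependsOn M ((Finset.univ.image e)ᶜ : Finset ι)) :
    ∫ x, centeredQuad e M x ^ 2 ∂stdGaussianPi ι
      = 2 * ∫ x, ∑ a, ∑ b, M x a b ^ 2 ∂stdGaussianPi ι := by
  have hI := integrable_centeredQuad_term (e := e) hM hC
  have hint : ∀ a b c d, Integrable (fun x => M x a b * M x c d) (stdGaussianPi ι) := fun a b c d =>
    integrable_mul_of_bounded (hM a b) (hC · a b)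
      (by simpa using integrable_mul_of_bounded (hM c d) (hC · c d) (integrable_const 1))
  have hterm : ∀ a b c d, ∫ x, M x a b * M x c d *
      ((x (e a) * x (e b) - if a = b then 1 else 0)
        * (x (e c) * x (e d) - if c = d then 1 else 0)) ∂stdGaussianPi ι
      = (∫ x, M x a b * M x c d ∂stdGaussianPi ι) *
        ((if a = c then 1 else 0) * (if b = d then 1 else 0)
        + (if a = d then 1 else 0) * (if b = c then 1 else 0)) := by
    intro a b c d
    have hind := indepFun_of_dependsOn (disjoint_compl_left (a := Finset.univ.image e))
      (φ := fun x => M x a b * M x c d)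
      (ψ := fun x => (x (e a) * x (e b) - if a = b then 1 else 0)
        * (x (e c) * x (e d) - if c = d then 1 else 0))
      ((hM a b).mul (hM c d)) (by fun_prop)
      (fun x y h => by simp only [hdep h]) (fun x y h => by
        simp only [h (e a) (by simp), h (e b) (by simp), h (e c) (by simp), h (e d) (by simp)])
    rw [hind.integral_fun_mul_eq_mul_integral ((hM a b).mul (hM c d)).aestronglyMeasurable
      (by fun_prop), integral_centered_prod_mul he]
  simp only [centeredQuad_sq]
  rw [integral_finsetSum _ fun a _ => integrable_finsetSum _ fun b _ =>
    integrable_finsetSum _ fun c _ => integrable_finsetSum _ fun d _ => hI a b c d,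
    integral_finsetSum _ fun a _ => integrable_finsetSum _ fun b _ => by
      simpa only [pow_two] using hint a b a b, Finset.mul_sum]
  refine Finset.sum_congr rfl fun a _ => ?_
  rw [integral_finsetSum _ fun b _ =>
    integrable_finsetSum _ fun c _ => integrable_finsetSum _ fun d _ => hI a b c d,
    integral_finsetSum _ fun b _ => by simpa only [pow_two] using hint a b a b, Finset.mul_sum]
  refine Finset.sum_congr rfl fun b _ => ?_
  rw [integral_finsetSum _ fun c _ => integrable_finsetSum _ fun d _ => hI a b c d]
  simp only [integral_finsetSum _ fun d _ => hI a b _ d, hterm, mul_add, Finset.sum_add_distrib]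
  have hsymm : ∀ x, M x b a = M x a b := fun x => (hs x).apply a b
  simp [Finset.sum_ite_eq, hsymm, pow_two, two_mul]

end StdGaussian

/-! ### Approximate fixed points -/

/-- The rational function `s ↦ d s / (1 + d s)`. -/
noncomputable def satur (d s : ℝ) : ℝ := d * s / (1 + d * s)

theorem satur_sub {d s t : ℝ} (hd : 0 ≤ d) (hs : 0 ≤ s) (ht : 0 ≤ t) :
    satur d s - satur d t = d * (s - t) / ((1 + d * s) * (1 + d * t)) := by
  have h1 : 0 < 1 + d * s := by positivity
  have h2 : 0 < 1 + d * t := by positivity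
  unfold satur
  field_simp
  ring

theorem abs_satur_sub_le {d s t : ℝ} (hd : 0 ≤ d) (hs : 0 ≤ s) (ht : 0 ≤ t) :
    |satur d s - satur d t| ≤ d * |s - t| := by
  have h1 : 1 ≤ (1 + d * s) * (1 + d * t) := by
    nlinarith [mul_nonneg hd hs, mul_nonneg hd ht, mul_nonneg (mul_nonneg hd hs) (mul_nonneg hd ht)]
  rw [satur_sub hd hs ht, abs_div, abs_mul, abs_of_nonneg hd, abs_of_pos (zero_lt_one.trans_le h1)]
  exact div_le_self (by positivity) h1

theorem satur_sub_mul_nonneg {d s t : ℝ} (hd : 0 ≤ d) (hs : 0 ≤ s) (ht : 0 ≤ t) :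
    0 ≤ (satur d s - satur d t) * (s - t) := by
  rw [satur_sub hd hs ht]
  have : d * (s - t) / ((1 + d * s) * (1 + d * t)) * (s - t)
      = d * (s - t) ^ 2 / ((1 + d * s) * (1 + d * t)) := by ring
  rw [this]
  positivity

theorem satur_nonneg {d s : ℝ} (hd : 0 ≤ d) (hs : 0 ≤ s) : 0 ≤ satur d s := by
  unfold satur; positivity

theorem satur_le_one {d s : ℝ} (hd : 0 ≤ d) (hs : 0 ≤ s) : satur d s ≤ 1 := by
  unfold satur
  have : 0 ≤ d * s := mul_nonneg hd hs
  rw [div_le_one (by linarith)]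
  linarith

/-- The second order remainder of `satur d` at `t`. -/
noncomputable def saturRem (d t s : ℝ) : ℝ :=
  d / (1 + d * t) ^ 2 * (s - t) - (satur d s - satur d t)

/-- The remainder equals `(d / (1 + d t))² (s - t)² / (1 + d s)`, nonnegative because `satur d` is
concave. For fixed `t > 0` its coefficient stays below `1 / t²` however large `d` is. -/
theorem saturRem_bounds {d s t : ℝ} (hd : 0 ≤ d) (hs : 0 ≤ s) (ht : 0 ≤ t) :
    0 ≤ saturRem d t s ∧ saturRem d t s ≤ (d / (1 + d * t)) ^ 2 * (s - t) ^ 2 := by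
  have h1 : 0 < 1 + d * s := by positivity
  have h2 : 0 < 1 + d * t := by positivity
  have e : saturRem d t s = (d / (1 + d * t)) ^ 2 * (s - t) ^ 2 / (1 + d * s) := by
    unfold saturRem
    rw [satur_sub hd hs ht]
    field_simp
    ring
  rw [e]
  exact ⟨by positivity, div_le_self (by positivity) (by nlinarith [mul_nonneg hd hs])⟩

/-- Subtracting the two equations gives `λ (τ - m) + D = -A`, where `A` is the cost of replacing
each `g k` by `τ`. As `satur` is increasing, `D` has the sign of `τ - m`, so `λ |τ - m| ≤ |A|`. The
Lipschitz bound and Cauchy–Schwarz with weights `d k` control `A`. -/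
theorem deterministic_fixed_point_stability {ι : Type*} [Fintype ι] {lam p τ m : ℝ} {d g : ι → ℝ}
    (hlam : 0 < lam) (hp : 0 < p) (hd : ∀ k, 0 ≤ d k) (hm : 0 ≤ m) (hτ : 0 ≤ τ)
    (hg : ∀ k, 0 ≤ g k)
    (h1 : lam * τ + (1 / p) * ∑ k, satur (d k) (g k) = 1)
    (h2 : lam * m + (1 / p) * ∑ k, satur (d k) m = 1) :
    (τ - m) ^ 2 ≤ ((1 / p) * ∑ k, d k) / lam ^ 2 * ((1 / p) * ∑ k, d k * (g k - τ) ^ 2) := by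
  set A := (1 / p) * ∑ k, (satur (d k) (g k) - satur (d k) τ) with hA
  set D := (1 / p) * ∑ k, (satur (d k) τ - satur (d k) m) with hD
  have hsum : lam * (τ - m) + D = -A := by
    rw [hA, hD, Finset.sum_sub_distrib, Finset.sum_sub_distrib]
    linear_combination h1 - h2
  have hDm : 0 ≤ D * (τ - m) := by
    rw [hD, mul_assoc, Finset.sum_mul]
    exact mul_nonneg (by positivity)
      (Finset.sum_nonneg fun k _ => satur_sub_mul_nonneg (hd k) hτ hm)
  have hAle : |A| ≤ (1 / p) * ∑ k, d k * |g k - τ| := by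
    rw [hA, abs_mul, abs_of_pos (by positivity : 0 < 1 / p)]
    refine mul_le_mul_of_nonneg_left ?_ (by positivity)
    exact (Finset.abs_sum_le_sum_abs _ _).trans
      (Finset.sum_le_sum fun k _ => abs_satur_sub_le (hd k) (hg k) hτ)
  have hCS : (∑ k, d k * |g k - τ|) ^ 2 ≤ (∑ k, d k) * ∑ k, d k * (g k - τ) ^ 2 :=
    Finset.sum_sq_le_sum_mul_sum_of_sq_le_mul _ (fun k _ => hd k)
      (fun k _ => mul_nonneg (hd k) (sq_nonneg _))
      (fun k _ => by rw [mul_pow, sq_abs]; exact le_of_eq (by ring))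
  have hlt : lam * (τ - m) ^ 2 ≤ |A| * |τ - m| := by
    have : lam * (τ - m) ^ 2 = -A * (τ - m) - D * (τ - m) := by rw [← hsum]; ring
    rw [this]
    have h3 : -A * (τ - m) ≤ |A| * |τ - m| := by
      rw [← abs_neg A, ← abs_mul]; exact le_abs_self _
    linarith
  have hlt2 : lam * |τ - m| ≤ |A| := by
    rcases (abs_nonneg (τ - m)).eq_or_lt with h0 | h0
    · rw [← h0]; simp
    · rw [← sq_abs] at hlt
      exact le_of_mul_le_mul_right (by linarith) h0
  have hfin : lam ^ 2 * (τ - m) ^ 2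
      ≤ ((1 / p) * ∑ k, d k) * ((1 / p) * ∑ k, d k * (g k - τ) ^ 2) := by
    calc lam ^ 2 * (τ - m) ^ 2 = (lam * |τ - m|) ^ 2 := by rw [mul_pow, sq_abs]
      _ ≤ ((1 / p) * ∑ k, d k * |g k - τ|) ^ 2 :=
          pow_le_pow_left₀ (by positivity) (hlt2.trans hAle) 2
      _ = (1 / p) ^ 2 * (∑ k, d k * |g k - τ|) ^ 2 := by rw [mul_pow]
      _ ≤ (1 / p) ^ 2 * ((∑ k, d k) * ∑ k, d k * (g k - τ) ^ 2) :=
          mul_le_mul_of_nonneg_left hCS (by positivity)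
      _ = _ := by ring
  rw [div_mul_eq_mul_div, le_div_iff₀ (by positivity)]
  linarith

/-- The second moment constant in `integral_satur_sub_le`. -/
noncomputable def momentConst (lam s : ℝ) : ℝ := 12 * (1 + s ^ 2 / lam ^ 2) / lam ^ 2

/-- The constant of the deterministic equivalent. -/
noncomputable def equivConst (lam s : ℝ) : ℝ :=
  (lam + s) * (s * (1 / lam + momentConst lam s * (lam + s)) / lam + 1 / lam)
    + (lam + s) ^ 2 * momentConst lam s

theorem momentConst_pos {lam s : ℝ} (hlam : 0 < lam) : 0 < momentConst lam s := by
  unfold momentConst; positivity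

theorem equivConst_pos {lam s : ℝ} (hlam : 0 < lam) (hs : 0 ≤ s) : 0 < equivConst lam s := by
  have := momentConst_pos (s := s) hlam
  unfold equivConst; positivity

/-- The probabilistic core, stripped of matrices: `τ` is the normalized trace, `σ k` the same with
row `k` left out, and `g k` the quadratic form that fluctuates around `σ k`. The second moments of
`g k - m` are `O(1/p)`; averaging a second order expansion at `m` then gives a bias of the same
order `1/p`, instead of the `p^{-1/2}` of a direct Lipschitz estimate. -/
theorem integral_satur_sub_le {Ω ι : Type*} [MeasurableSpace Ω] {μ : Measure Ω}
    [IsProbabilityMeasure μ] [Fintype ι] {lam p m : ℝ} {d : ι → ℝ} {τ : Ω → ℝ} {σ g : ι → Ω → ℝ}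
    (hlam : 0 < lam) (hp : 1 ≤ p) (hd : ∀ k, 0 ≤ d k) (hm : 0 < m)
    (hτ0 : ∀ ω, 0 ≤ τ ω) (hg0 : ∀ k ω, 0 ≤ g k ω)
    (hτ2 : MemLp τ 2 μ) (hσ2 : ∀ k, MemLp (σ k) 2 μ) (hgσ2 : ∀ k, MemLp (fun ω => g k ω - σ k ω) 2 μ)
    (hστ : ∀ k ω, |σ k ω - τ ω| ≤ 1 / (lam * p))
    (hmean : ∀ k, ∫ ω, (g k ω - σ k ω) ∂μ = 0)
    (hvar : ∀ k, ∫ ω, (g k ω - σ k ω) ^ 2 ∂μ ≤ 2 / (p * lam ^ 2))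
    (hid : ∀ ω, lam * τ ω + (1 / p) * ∑ k, satur (d k) (g k ω) = 1)
    (hmeq : lam * m + (1 / p) * ∑ k, satur (d k) m = 1) (k : ι) :
    |∫ ω, satur (d k) (g k ω) ∂μ - satur (d k) m| ≤ equivConst lam ((1 / p) * ∑ k, d k) / p := by
  have hp0 : 0 < p := by linarith
  set s := (1 / p) * ∑ k, d k with hs
  have hs0 : 0 ≤ s := mul_nonneg (by positivity) (Finset.sum_nonneg fun k _ => hd k)
  have hg2 : ∀ k, MemLp (g k) 2 μ := fun k => by
    have h : g k = (fun ω => g k ω - σ k ω) + σ k := by ext ω; simp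
    rw [h]
    exact (hgσ2 k).add (hσ2 k)
  have hτ1 := hτ2.integrable (by norm_num)
  have hσ1 := fun k => (hσ2 k).integrable (by norm_num)
  have hg1 := fun k => (hg2 k).integrable (by norm_num)
  have hgτsq : ∀ k, Integrable (fun ω => (g k ω - τ ω) ^ 2) μ := fun k =>
    ((hg2 k).sub hτ2).integrable_sq
  have hτmsq : Integrable (fun ω => (τ ω - m) ^ 2) μ :=
    (hτ2.sub (memLp_const m)).integrable_sq
  have hgmsq : ∀ k, Integrable (fun ω => (g k ω - m) ^ 2) μ := fun k =>
    ((hg2 k).sub (memLp_const m)).integrable_sq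
  -- the second moment of `g k - τ`
  have hQ : ∀ k, ∫ ω, (g k ω - τ ω) ^ 2 ∂μ ≤ 6 / (p * lam ^ 2) := fun k => by
    have hpt : ∀ ω, (g k ω - τ ω) ^ 2 ≤ 2 * (g k ω - σ k ω) ^ 2 + 2 * (1 / (lam * p)) ^ 2 := by
      intro ω
      have h1 : (σ k ω - τ ω) ^ 2 ≤ (1 / (lam * p)) ^ 2 := sq_le_sq' (abs_le.1 (hστ k ω)).1
        (abs_le.1 (hστ k ω)).2
      nlinarith [sq_nonneg ((g k ω - σ k ω) - (σ k ω - τ ω))]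
    have h2 := integral_mono (hgτsq k)
      (((hgσ2 k).integrable_sq.const_mul 2).add (integrable_const (2 * (1 / (lam * p)) ^ 2))) hpt
    simp only [Pi.add_apply] at h2
    rw [integral_add ((hgσ2 k).integrable_sq.const_mul 2) (integrable_const _),
      integral_const_mul, integral_const, probReal_univ, one_smul] at h2
    -- Here `1 ≤ p` absorbs the squared deterministic error `1 / (λ p)²` into the variance scale.
    have h3 : (1 / (lam * p)) ^ 2 ≤ 1 / (p * lam ^ 2) := by
      rw [div_pow, one_pow]
      refine one_div_le_one_div_of_le (by positivity) ?_
      have : p * lam ^ 2 * 1 ≤ p * lam ^ 2 * p := mul_le_mul_of_nonneg_left hp (by positivity)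
      linarith [this, (by ring : (lam * p) ^ 2 = p * lam ^ 2 * p)]
    have h4 : 6 / (p * lam ^ 2) = 2 * (2 / (p * lam ^ 2)) + 2 * (1 / (p * lam ^ 2)) := by ring
    rw [h4]
    linarith [hvar k]
  -- the second moment of `τ - m`
  have hτm : ∫ ω, (τ ω - m) ^ 2 ∂μ ≤ s ^ 2 / lam ^ 2 * (6 / (p * lam ^ 2)) := by
    have hint : Integrable (fun ω => s / lam ^ 2 * ((1 / p) * ∑ k, d k * (g k ω - τ ω) ^ 2)) μ :=
      ((integrable_finsetSum _ fun k _ => (hgτsq k).const_mul (d k)).const_mul _).const_mul _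
    have h2 := integral_mono hτmsq hint fun ω =>
      deterministic_fixed_point_stability hlam hp0 hd hm.le (hτ0 ω) (hg0 · ω) (hid ω) hmeq
    rw [integral_const_mul, integral_const_mul,
      integral_finsetSum _ fun k _ => (hgτsq k).const_mul (d k)] at h2
    simp only [integral_const_mul] at h2
    refine h2.trans ?_
    have h3 : ∑ k, d k * ∫ ω, (g k ω - τ ω) ^ 2 ∂μ ≤ (∑ k, d k) * (6 / (p * lam ^ 2)) := by
      rw [Finset.sum_mul]
      exact Finset.sum_le_sum fun k _ => mul_le_mul_of_nonneg_left (hQ k) (hd k)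
    calc s / lam ^ 2 * ((1 / p) * ∑ k, d k * ∫ ω, (g k ω - τ ω) ^ 2 ∂μ)
        ≤ s / lam ^ 2 * ((1 / p) * ((∑ k, d k) * (6 / (p * lam ^ 2)))) := by gcongr
      _ = s ^ 2 / lam ^ 2 * (6 / (p * lam ^ 2)) := by rw [hs]; ring
  -- the second moment of `g k - m`
  set R := momentConst lam s with hR
  have hR0 : 0 < R := momentConst_pos hlam
  have hgm : ∀ k, ∫ ω, (g k ω - m) ^ 2 ∂μ ≤ R / p := fun k => by
    have hpt : ∀ ω, (g k ω - m) ^ 2 ≤ 2 * (g k ω - τ ω) ^ 2 + 2 * (τ ω - m) ^ 2 := fun ω => by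
      nlinarith [sq_nonneg ((g k ω - τ ω) - (τ ω - m))]
    have h2 := integral_mono (hgmsq k) (((hgτsq k).const_mul 2).add (hτmsq.const_mul 2)) hpt
    simp only [Pi.add_apply] at h2
    rw [integral_add ((hgτsq k).const_mul 2) (hτmsq.const_mul 2),
      integral_const_mul, integral_const_mul] at h2
    have h3 : R / p = 2 * (6 / (p * lam ^ 2)) + 2 * (s ^ 2 / lam ^ 2 * (6 / (p * lam ^ 2))) := by
      rw [hR, momentConst]; field_simp; ring
    rw [h3]
    linarith [hQ k]
  -- expansion of the expectations
  have hsat : ∀ k, Integrable (fun ω => satur (d k) (g k ω)) μ := fun k => by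
    refine Integrable.of_bound (C := 1) ?_ (Filter.Eventually.of_forall fun ω => ?_)
    · have hm1 : AEMeasurable (g k) μ := (hg2 k).aestronglyMeasurable.aemeasurable
      unfold satur
      exact ((hm1.const_mul _).div ((hm1.const_mul _).const_add _)).aestronglyMeasurable
    · rw [Real.norm_eq_abs, abs_of_nonneg (satur_nonneg (hd k) (hg0 k ω))]
      exact satur_le_one (hd k) (hg0 k ω)
  set e := ∫ ω, τ ω ∂μ - m with he
  set δ : ι → ℝ := fun k => ∫ ω, (σ k ω - τ ω) ∂μ with hδ
  set ρ : ι → ℝ := fun k => ∫ ω, saturRem (d k) m (g k ω) ∂μ with hρ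
  have hδle : ∀ k, |δ k| ≤ 1 / (lam * p) := fun k => by
    have := norm_integral_le_of_norm_le_const (μ := μ) (f := fun ω => σ k ω - τ ω)
      (C := 1 / (lam * p)) (Filter.Eventually.of_forall fun ω => hστ k ω)
    simpa only [probReal_univ, mul_one] using! this
  have hremint : ∀ k, Integrable (fun ω => saturRem (d k) m (g k ω)) μ := fun k =>
    (((hg1 k).sub (integrable_const m)).const_mul _).sub ((hsat k).sub (integrable_const _))
  have hρ0 : ∀ k, 0 ≤ ρ k := fun k =>
    integral_nonneg fun ω => (saturRem_bounds (hd k) (hg0 k ω) hm.le).1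
  have hρle : ∀ k, ρ k ≤ (d k / (1 + d k * m)) ^ 2 * (R / p) := fun k => by
    have h2 := integral_mono (hremint k) ((hgmsq k).const_mul ((d k / (1 + d k * m)) ^ 2))
      fun ω => (saturRem_bounds (hd k) (hg0 k ω) hm.le).2
    rw [integral_const_mul] at h2
    exact h2.trans (mul_le_mul_of_nonneg_left (hgm k) (sq_nonneg _))
  -- Since `g k` and `σ k` have the same mean, the linear term sees only the bias `e` of `τ` and the
  -- leave-one-out shift `δ k`; `ρ k` is the quadratic remainder.
  have hexp : ∀ k, ∫ ω, satur (d k) (g k ω) ∂μ - satur (d k) m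
      = d k / (1 + d k * m) ^ 2 * (e + δ k) - ρ k := fun k => by
    have h1 : ρ k = d k / (1 + d k * m) ^ 2 * (∫ ω, g k ω ∂μ - m)
        - (∫ ω, satur (d k) (g k ω) ∂μ - satur (d k) m) := by
      simp only [hρ, saturRem]
      rw [integral_sub (by exact ((hg1 k).sub (integrable_const m)).const_mul _)
        (by exact (hsat k).sub (integrable_const _)), integral_const_mul,
        integral_sub (hg1 k) (integrable_const m), integral_sub (hsat k) (integrable_const _)]
      simp
    have h2 : ∫ ω, g k ω ∂μ = ∫ ω, σ k ω ∂μ := by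
      have := hmean k
      rw [integral_sub (hg1 k) (hσ1 k)] at this
      linarith
    have h3 : δ k = ∫ ω, σ k ω ∂μ - ∫ ω, τ ω ∂μ := integral_sub (hσ1 k) hτ1
    rw [h1, h2, h3, he]; ring
  -- Expectation of the random identity minus the equation for `m`: a scalar equation that
  -- determines `e` up to `O(1/p)`.
  have hbal : lam * e + (1 / p) * ∑ k, (∫ ω, satur (d k) (g k ω) ∂μ - satur (d k) m) = 0 := by
    have h1 : ∫ ω, (lam * τ ω + (1 / p) * ∑ k, satur (d k) (g k ω)) ∂μ = 1 := by
      simp only [hid, integral_const, probReal_univ, one_smul]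
    rw [integral_add (hτ1.const_mul _)
      ((integrable_finsetSum _ fun k _ => hsat k).const_mul _), integral_const_mul,
      integral_const_mul, integral_finsetSum _ fun k _ => hsat k] at h1
    rw [Finset.sum_sub_distrib, he]
    linear_combination h1 - hmeq
  have hα0 : ∀ k, 0 ≤ d k / (1 + d k * m) ^ 2 := fun k => div_nonneg (hd k) (sq_nonneg _)
  have hdm : ∀ k, 0 ≤ d k * m := fun k => mul_nonneg (hd k) hm.le
  have hαd : ∀ k, d k / (1 + d k * m) ^ 2 ≤ d k := fun k =>
    div_le_self (hd k) (by nlinarith [hdm k])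
  -- The bounds by `d k` serve under the sum over `k`, where `∑ d k / p = s`; the bounds by powers
  -- of `1 / m` serve for a single `k`, uniformly in `d k`.
  have hαm : ∀ k, d k / (1 + d k * m) ^ 2 ≤ 1 / m := fun k => by
    rw [div_le_div_iff₀ (by have := hdm k; positivity) hm]; nlinarith [hdm k]
  have hκd : ∀ k, (d k / (1 + d k * m)) ^ 2 ≤ d k * (1 / m) := fun k => by
    rw [div_pow, mul_one_div, div_le_div_iff₀ (by have := hdm k; positivity) hm]
    have h2 : d k * m ≤ (1 + d k * m) ^ 2 := by nlinarith [hdm k]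
    have := mul_le_mul_of_nonneg_left h2 (hd k)
    linarith [(by ring : d k * (d k * m) = d k ^ 2 * m)]
  have hκm : ∀ k, (d k / (1 + d k * m)) ^ 2 ≤ (1 / m) ^ 2 := fun k => by
    refine pow_le_pow_left₀ (div_nonneg (hd k) (by linarith [hdm k])) ?_ 2
    rw [div_le_div_iff₀ (by linarith [hdm k]) hm]; linarith
  -- From `satur d m ≤ d m` the equation for `m` gives `1 ≤ (λ + s) m`.
  have hmL : 1 / m ≤ lam + s := by
    have h1 : (1 / p) * ∑ k, satur (d k) m ≤ s * m := by
      rw [hs, mul_assoc, Finset.sum_mul]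
      refine mul_le_mul_of_nonneg_left (Finset.sum_le_sum fun k _ => ?_) (by positivity)
      exact div_le_self (hdm k) (by linarith [hdm k])
    rw [div_le_iff₀ hm]
    linarith
  -- the bias of `τ`
  have hele : |e| ≤ s * (1 / lam + R * (lam + s)) / lam / p := by
    -- Inserting the expansions in `hbal` puts all the `e` on one side, with a coefficient at least
    -- `λ`.
    have h1 : (lam + (1 / p) * ∑ k, d k / (1 + d k * m) ^ 2) * e
        = -((1 / p) * ∑ k, (d k / (1 + d k * m) ^ 2 * δ k - ρ k)) := by
      have h2 : ∑ k, (∫ ω, satur (d k) (g k ω) ∂μ - satur (d k) m)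
          = (∑ k, d k / (1 + d k * m) ^ 2) * e
            + ∑ k, (d k / (1 + d k * m) ^ 2 * δ k - ρ k) := by
        rw [Finset.sum_mul, ← Finset.sum_add_distrib]
        exact Finset.sum_congr rfl fun k _ => by rw [hexp k]; ring
      rw [h2] at hbal
      linear_combination hbal
    have h3 : |(1 / p) * ∑ k, (d k / (1 + d k * m) ^ 2 * δ k - ρ k)|
        ≤ s * (1 / (lam * p) + (lam + s) * (R / p)) := by
      rw [abs_mul, abs_of_pos (by positivity : 0 < 1 / p), hs, mul_assoc, Finset.sum_mul]
      refine mul_le_mul_of_nonneg_left ((Finset.abs_sum_le_sum_abs _ _).trans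
        (Finset.sum_le_sum fun k _ => (abs_sub _ _).trans ?_)) (by positivity)
      rw [abs_mul, abs_of_nonneg (hα0 k), abs_of_nonneg (hρ0 k), mul_add]
      refine add_le_add (mul_le_mul (hαd k) (hδle k) (abs_nonneg _) (hd k)) ?_
      refine (hρle k).trans ?_
      rw [← mul_assoc]
      refine mul_le_mul_of_nonneg_right ((hκd k).trans ?_) (by positivity)
      exact mul_le_mul_of_nonneg_left hmL (hd k)
    have h4 : lam * |e| ≤ |(lam + (1 / p) * ∑ k, d k / (1 + d k * m) ^ 2) * e| := by
      rw [abs_mul]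
      refine mul_le_mul_of_nonneg_right (le_trans ?_ (le_abs_self _)) (abs_nonneg _)
      exact le_add_of_nonneg_right
        (mul_nonneg (by positivity) (Finset.sum_nonneg fun k _ => hα0 k))
    rw [h1, abs_neg] at h4
    have h5 : s * (1 / lam + R * (lam + s)) / lam / p
        = s * (1 / (lam * p) + (lam + s) * (R / p)) / lam := by field_simp
    rw [h5, le_div_iff₀ hlam]
    linarith
  rw [hexp k]
  have hL0 : 0 ≤ lam + s := by positivity
  calc |d k / (1 + d k * m) ^ 2 * (e + δ k) - ρ k|
      ≤ |d k / (1 + d k * m) ^ 2 * (e + δ k)| + |ρ k| := abs_sub _ _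
    _ ≤ (lam + s) * (s * (1 / lam + R * (lam + s)) / lam / p + 1 / (lam * p))
        + (lam + s) ^ 2 * (R / p) := by
        rw [abs_mul, abs_of_nonneg (hα0 k), abs_of_nonneg (hρ0 k)]
        refine add_le_add (mul_le_mul ((hαm k).trans hmL)
          ((abs_add_le _ _).trans (add_le_add hele (hδle k))) (abs_nonneg _) hL0) ?_
        refine (hρle k).trans (mul_le_mul_of_nonneg_right ((hκm k).trans ?_) (by positivity))
        exact pow_le_pow_left₀ (by positivity) hmL 2
    _ = equivConst lam s / p := by rw [equivConst, ← hR]; field_simp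

/-! ### The deterministic equivalent of the resolvent -/

section DeterministicEquivalent

variable {N P : ℕ} {lam : ℝ} {c : Fin N → ℝ}

/-- The rows of a family indexed by pairs. -/
def rows (x : Fin N × Fin P → ℝ) (k : Fin N) (a : Fin P) : ℝ := x (k, a)

/-- The resolvent `(λ I + ∑ₖ cₖ wₖ wₖᵀ)⁻¹` as a function of the rows. -/
noncomputable def resolvent (lam : ℝ) (c : Fin N → ℝ) (x : Fin N × Fin P → ℝ) :
    Matrix (Fin P) (Fin P) ℝ :=
  (regMoment lam c (rows x))⁻¹

theorem continuous_resolvent (hlam : 0 < lam) (hc : ∀ k, 0 ≤ c k) (a b : Fin P) :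
    Continuous fun x : Fin N × Fin P → ℝ => resolvent lam c x a b := by
  have h : Continuous (rows : (Fin N × Fin P → ℝ) → Fin N → Fin P → ℝ) := by
    unfold rows; fun_prop
  exact (continuous_resolvent_apply hlam hc a b).comp h

theorem abs_resolvent_le (hlam : 0 < lam) (hc : ∀ k, 0 ≤ c k) (x : Fin N × Fin P → ℝ)
    (a b : Fin P) : |resolvent lam c x a b| ≤ 1 / lam :=
  abs_inv_apply_le hlam (regMoment_isSymm _) (regMoment_coercive hc _) a b

theorem integrable_rows_resolvent (hlam : 0 < lam) (hc : ∀ k, 0 ≤ c k) (k l : Fin N) :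
    Integrable (fun x : Fin N × Fin P → ℝ => rows x k ⬝ᵥ resolvent lam c x *ᵥ rows x l)
      (stdGaussianPi (Fin N × Fin P)) := by
  simp only [dotProduct, Matrix.mulVec, Finset.mul_sum]
  refine integrable_finsetSum _ fun a _ => integrable_finsetSum _ fun b _ => ?_
  have := integrable_mul_of_bounded (continuous_resolvent hlam hc a b).measurable
    (abs_resolvent_le hlam hc · a b) (integrable_prod_two_stdGaussianPi (k, a) (l, b))
  refine this.congr (Filter.Eventually.of_forall fun x => ?_)
  simp only [rows]; ring

theorem rows_signFlip (k l : Fin N) (x : Fin N × Fin P → ℝ) :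
    rows (signFlip (Finset.univ.image fun a => (k, a)) x) l =
      if l = k then -rows x l else rows x l := by
  ext a
  by_cases h : l = k
  · subst h; simp [rows, signFlip]
  · simp [rows, signFlip, h, Ne.symm h]

/-- The resolvent depends on each row only through `w wᵀ`, hence is even in it. This makes the
off-diagonal forms odd, with zero expectation. -/
theorem resolvent_signFlip (k : Fin N) (x : Fin N × Fin P → ℝ) :
    resolvent lam c (signFlip (Finset.univ.image fun a => (k, a)) x) = resolvent lam c x := by
  unfold resolvent regMoment
  congr 2
  refine Finset.sum_congr rfl fun l _ => ?_
  rw [rows_signFlip]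
  split_ifs <;> simp [Matrix.neg_vecMulVec, Matrix.vecMulVec_neg]

theorem integral_rows_resolvent_of_ne {k l : Fin N} (h : k ≠ l) :
    ∫ x : Fin N × Fin P → ℝ, rows x k ⬝ᵥ resolvent lam c x *ᵥ rows x l
      ∂stdGaussianPi (Fin N × Fin P) = 0 := by
  refine integral_eq_zero_of_signFlip (Finset.univ.image fun a => (k, a)) fun x => ?_
  rw [resolvent_signFlip, rows_signFlip, rows_signFlip, if_pos rfl, if_neg h.symm, neg_dotProduct]

theorem dependsOn_resolvent_update (k : Fin N) :
    DependsOn (resolvent (P := P) lam (Function.update c k 0))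
      ((Finset.univ.image fun a : Fin P => (k, a))ᶜ : Finset (Fin N × Fin P)) := by
  intro x y h
  unfold resolvent regMoment
  congr 2
  refine Finset.sum_congr rfl fun l _ => ?_
  by_cases hl : l = k
  · subst hl; simp
  · have : rows x l = rows y l := by
      ext a
      exact h (l, a) (by simp [Ne.symm hl])
    rw [this]

/-- The normalized trace of the resolvent. -/
noncomputable def normTrace (lam : ℝ) (c : Fin N → ℝ) (x : Fin N × Fin P → ℝ) : ℝ :=
  1 / (P : ℝ) * (resolvent lam c x).trace

/-- The normalized quadratic form of the resolvent with the `k`-th row left out, evaluated at the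
`k`-th row. -/
noncomputable def looQuad (lam : ℝ) (c : Fin N → ℝ) (k : Fin N) (x : Fin N × Fin P → ℝ) : ℝ :=
  1 / (P : ℝ) * (rows x k ⬝ᵥ resolvent lam (Function.update c k 0) x *ᵥ rows x k)

theorem normTrace_nonneg (hlam : 0 < lam) (hc : ∀ k, 0 ≤ c k) (x : Fin N × Fin P → ℝ) :
    0 ≤ normTrace lam c x := by
  refine mul_nonneg (by positivity) (Finset.sum_nonneg fun a _ => ?_)
  have := quad_inv_nonneg hlam (regMoment_isSymm (rows x)) (regMoment_coercive hc (rows x))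
    (Pi.single a 1)
  simpa [resolvent] using this

theorem looQuad_nonneg (hlam : 0 < lam) (hc : ∀ k, 0 ≤ c k) (k : Fin N)
    (x : Fin N × Fin P → ℝ) : 0 ≤ looQuad lam c k x :=
  mul_nonneg (by positivity) (quad_inv_nonneg hlam (regMoment_isSymm (rows x))
    (regMoment_coercive (update_zero_nonneg hc k) (rows x)) _)

theorem memLp_normTrace (hlam : 0 < lam) (hc : ∀ k, 0 ≤ c k) :
    MemLp (normTrace (P := P) lam c) 2 (stdGaussianPi (Fin N × Fin P)) := by
  have h : ∀ a : Fin P, MemLp (fun x : Fin N × Fin P → ℝ => resolvent lam c x a a) 2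
      (stdGaussianPi (Fin N × Fin P)) := fun a =>
    MemLp.of_bound (continuous_resolvent hlam hc a a).measurable.aestronglyMeasurable (1 / lam)
      (Filter.Eventually.of_forall fun x => abs_resolvent_le hlam hc x a a)
  have hs := memLp_finsetSum Finset.univ fun a _ => h a
  exact hs.const_mul (1 / (P : ℝ))

/-- This difference is a centered Gaussian quadratic form whose matrix does not involve row `k`, so
its mean and variance are explicit. -/
theorem looQuad_sub_normTrace (k : Fin N) (x : Fin N × Fin P → ℝ) :
    looQuad lam c k x - normTrace lam (Function.update c k 0) x
      = 1 / (P : ℝ) * centeredQuad (fun a => (k, a))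
          (resolvent lam (Function.update c k 0)) x := by
  rw [looQuad, normTrace, ← mul_sub, centeredQuad]
  simp only [mul_sub (resolvent _ _ _ _ _), Finset.sum_sub_distrib, Matrix.trace, Matrix.diag,
    dotProduct, Matrix.mulVec, rows, Finset.mul_sum, mul_ite, mul_one, mul_zero, Finset.sum_ite_eq,
    Finset.mem_univ, if_true]
  congr 2
  exact Finset.sum_congr rfl fun a _ => Finset.sum_congr rfl fun b _ => by ring

theorem abs_normTrace_update_sub_le (hlam : 0 < lam) (hP : 0 < P) (hc : ∀ k, 0 ≤ c k) (k : Fin N)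
    (x : Fin N × Fin P → ℝ) :
    |normTrace lam (Function.update c k 0) x - normTrace lam c x| ≤ 1 / (lam * P) := by
  have hP0 : (0 : ℝ) < P := by exact_mod_cast hP
  have h := abs_trace_inv_rank_one_le hlam (regMoment_isSymm (rows x))
    (regMoment_coercive hc (rows x)) (regMoment_isSymm (rows x))
    (regMoment_coercive (update_zero_nonneg hc k) (rows x)) (hc k) (regMoment_update (rows x) k)
  rw [normTrace, normTrace, ← mul_sub, abs_mul, abs_of_pos (by positivity)]
  calc 1 / (P : ℝ) * |(resolvent lam (Function.update c k 0) x).trace - (resolvent lam c x).trace|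
      ≤ 1 / (P : ℝ) * (1 / lam) := mul_le_mul_of_nonneg_left h (by positivity)
    _ = 1 / (lam * P) := by field_simp

/-- The rank-one formula for adding row `k` back; the factor `P` in the first argument of `satur`
cancels the normalization `1 / P` in `looQuad`. -/
theorem mul_quad_resolvent (hlam : 0 < lam) (hP : 0 < P) (hc : ∀ k, 0 ≤ c k) (k : Fin N)
    (x : Fin N × Fin P → ℝ) :
    c k * (rows x k ⬝ᵥ resolvent lam c x *ᵥ rows x k) = satur (P * c k) (looQuad lam c k x) := by
  have hP0 : (P : ℝ) ≠ 0 := by exact_mod_cast hP.ne'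
  have h := quad_inv_rank_one hlam (regMoment_isSymm (rows x)) (regMoment_coercive hc (rows x))
    (regMoment_isSymm (rows x)) (regMoment_coercive (update_zero_nonneg hc k) (rows x)) (hc k)
    (regMoment_update (rows x) k)
  have e : P * c k * looQuad lam c k x
      = c k * (rows x k ⬝ᵥ (regMoment lam (Function.update c k 0) (rows x))⁻¹ *ᵥ rows x k) := by
    rw [looQuad, resolvent]; field_simp
  rw [satur, e]
  exact h

theorem memLp_looQuad_sub (hlam : 0 < lam) (hc : ∀ k, 0 ≤ c k) (k : Fin N) :
    MemLp (fun x => looQuad lam c k x - normTrace (P := P) lam (Function.update c k 0) x) 2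
      (stdGaussianPi (Fin N × Fin P)) := by
  have hck := update_zero_nonneg hc k
  simp only [looQuad_sub_normTrace]
  have hm := fun a b => (continuous_resolvent (P := P) hlam hck a b).measurable
  exact MemLp.const_mul ((memLp_two_iff_integrable_sq
    (integrable_centeredQuad hm (abs_resolvent_le hlam hck)).aestronglyMeasurable).2
    (integrable_centeredQuad_sq hm (abs_resolvent_le hlam hck))) _

theorem injective_row (k : Fin N) : Function.Injective fun a : Fin P => (k, a) :=
  fun _ _ h => (Prod.mk.inj h).2

theorem integral_looQuad_sub (hlam : 0 < lam) (hc : ∀ k, 0 ≤ c k) (k : Fin N) :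
    ∫ x, (looQuad lam c k x - normTrace (P := P) lam (Function.update c k 0) x)
      ∂stdGaussianPi (Fin N × Fin P) = 0 := by
  have hck := update_zero_nonneg hc k
  simp only [looQuad_sub_normTrace]
  rw [integral_const_mul, integral_centeredQuad (injective_row k)
    (fun a b => (continuous_resolvent hlam hck a b).measurable) (abs_resolvent_le hlam hck)
    (dependsOn_resolvent_update k), mul_zero]

/-- The squared prefactor `1 / P²`, the factor `2` of the Gaussian variance and the Frobenius bound
`P / λ²` multiply to `2 / (P λ²)`. -/
theorem integral_looQuad_sub_sq_le (hlam : 0 < lam) (hP : 0 < P) (hc : ∀ k, 0 ≤ c k)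
    (k : Fin N) :
    ∫ x, (looQuad lam c k x - normTrace (P := P) lam (Function.update c k 0) x) ^ 2
      ∂stdGaussianPi (Fin N × Fin P) ≤ 2 / (P * lam ^ 2) := by
  have hP0 : (0 : ℝ) < P := by exact_mod_cast hP
  have hck := update_zero_nonneg hc k
  simp only [looQuad_sub_normTrace, mul_pow]
  rw [integral_const_mul, integral_centeredQuad_sq (injective_row k)
    (fun a b => (continuous_resolvent hlam hck a b).measurable) (abs_resolvent_le hlam hck)
    (fun x => isSymm_inv (regMoment_isSymm _)) (dependsOn_resolvent_update k)]
  have hle : ∫ x, ∑ a, ∑ b, resolvent lam (Function.update c k 0) x a b ^ 2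
      ∂stdGaussianPi (Fin N × Fin P) ≤ P / lam ^ 2 := by
    have hpt : ∀ x : Fin N × Fin P → ℝ,
        ∑ a, ∑ b, resolvent lam (Function.update c k 0) x a b ^ 2 ≤ P / lam ^ 2 := fun x => by
      have := sum_sq_inv_le hlam (regMoment_isSymm (rows x)) (regMoment_coercive hck (rows x))
      rwa [Fintype.card_fin] at this
    have h := integral_mono_of_nonneg (μ := stdGaussianPi (Fin N × Fin P))
      (Filter.Eventually.of_forall fun x => Finset.sum_nonneg fun a _ =>
        Finset.sum_nonneg fun b _ => sq_nonneg (resolvent lam (Function.update c k 0) x a b))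
      (integrable_const ((P : ℝ) / lam ^ 2)) (Filter.Eventually.of_forall hpt)
    rwa [integral_const, probReal_univ, one_smul] at h
  calc (1 / (P : ℝ)) ^ 2 * (2 * ∫ x, ∑ a, ∑ b, resolvent lam (Function.update c k 0) x a b ^ 2
        ∂stdGaussianPi (Fin N × Fin P))
      ≤ (1 / (P : ℝ)) ^ 2 * (2 * (P / lam ^ 2)) := by gcongr
    _ = 2 / (P * lam ^ 2) := by field_simp

theorem normTrace_identity (hlam : 0 < lam) (hP : 0 < P) (hc : ∀ k, 0 ≤ c k)
    (x : Fin N × Fin P → ℝ) :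
    lam * normTrace lam c x + 1 / (P : ℝ) * ∑ k, satur (P * c k) (looQuad lam c k x) = 1 := by
  have hP0 : (P : ℝ) ≠ 0 := by exact_mod_cast hP.ne'
  have h := trace_resolvent_identity hlam hc (rows x)
  rw [Fintype.card_fin] at h
  simp only [← mul_quad_resolvent hlam hP hc]
  have e : lam * normTrace lam c x = 1 / (P : ℝ) * (lam * (resolvent lam c x).trace) := by
    rw [normTrace]; ring
  rw [e, ← mul_add, one_div, inv_mul_eq_one₀ hP0]
  exact h.symm

theorem integral_quad_resolvent_sub_le (hlam : 0 < lam) (hP : 0 < P) (hc : ∀ k, 0 ≤ c k)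
    {m : ℝ} (hm : 0 < m)
    (hmeq : lam * m + (1 / (P : ℝ)) * ∑ k, satur (P * c k) m = 1) (k : Fin N) :
    |∫ x : Fin N × Fin P → ℝ, c k * (rows x k ⬝ᵥ resolvent lam c x *ᵥ rows x k)
        ∂stdGaussianPi (Fin N × Fin P) - satur (P * c k) m|
      ≤ equivConst lam ((1 / (P : ℝ)) * ∑ k, P * c k) / P := by
  have hP1 : (1 : ℝ) ≤ P := by exact_mod_cast hP
  simp only [mul_quad_resolvent hlam hP hc]
  exact integral_satur_sub_le (τ := normTrace lam c)
    (σ := fun k => normTrace lam (Function.update c k 0)) (g := looQuad lam c) hlam hP1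
    (fun k => mul_nonneg (by positivity) (hc k)) hm
    (normTrace_nonneg hlam hc) (looQuad_nonneg hlam hc) (memLp_normTrace hlam hc)
    (fun k => memLp_normTrace hlam (update_zero_nonneg hc k)) (memLp_looQuad_sub hlam hc)
    (abs_normTrace_update_sub_le hlam hP hc) (integral_looQuad_sub hlam hc)
    (integral_looQuad_sub_sq_le hlam hP hc) (normTrace_identity hlam hP hc) hmeq k

end DeterministicEquivalent

/-! ### The effective ridge -/

theorem satur_inv {d t : ℝ} (ht : 0 < t) : satur d t⁻¹ = d / (t + d) := by
  unfold satur
  have : 1 + d * t⁻¹ = (t + d) * t⁻¹ := by field_simp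
  rw [this, mul_div_mul_right _ _ (inv_ne_zero ht.ne')]

section EffectiveRidge

variable {N : ℕ} {lam q : ℝ} {d : Fin N → ℝ}

/-- In the variable `m = 1 / t` the left side is strictly increasing on `[0, ∞)`, vanishes at `0`
and exceeds `1` at `1 / λ`. Hence there is exactly one root, and `m < 1 / λ` means `λ < t`. -/
theorem exists_unique_effective (hN : 0 < N) (hlam : 0 < lam) (hq : 0 < q) (hd : ∀ k, 0 < d k) :
    ∃ t, lam < t ∧ lam * t⁻¹ + q * ∑ k, satur (d k) t⁻¹ = 1 ∧
      ∀ s, 0 < s → lam * s⁻¹ + q * ∑ k, satur (d k) s⁻¹ = 1 → s = t := by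
  let φ : ℝ → ℝ := fun m => lam * m + q * ∑ k, satur (d k) m
  have hmono : ∀ m m', 0 ≤ m → m < m' → φ m < φ m' := by
    intro m m' hm hmm
    refine add_lt_add_of_lt_of_le (mul_lt_mul_of_pos_left hmm hlam)
      (mul_le_mul_of_nonneg_left (Finset.sum_le_sum fun k _ => ?_) hq.le)
    have h := satur_sub_mul_nonneg (hd k).le (hm.trans hmm.le) hm
    have := nonneg_of_mul_nonneg_left h (sub_pos.2 hmm)
    linarith
  have hcont : ContinuousOn φ (Set.Icc 0 lam⁻¹) := by
    refine ContinuousOn.add (by fun_prop) (ContinuousOn.mul (by fun_prop)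
      (continuousOn_finsetSum _ fun k _ => ContinuousOn.div (by fun_prop) (by fun_prop) ?_))
    intro m hm
    have := mul_nonneg (hd k).le hm.1
    positivity
  have hsat : ∀ m, 0 < m → 0 < q * ∑ k, satur (d k) m := fun m hm => by
    refine mul_pos hq (Finset.sum_pos (fun k _ => ?_) ⟨⟨0, hN⟩, Finset.mem_univ _⟩)
    have := hd k
    unfold satur; positivity
  have h0 : φ 0 = 0 := by simp [φ, satur]
  have h1 : 1 < φ lam⁻¹ := by
    have := hsat lam⁻¹ (by positivity)
    have h2 : lam * lam⁻¹ = 1 := mul_inv_cancel₀ hlam.ne'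
    simp only [φ]; linarith
  obtain ⟨m, hm, hφ⟩ := intermediate_value_Icc (inv_pos.2 hlam).le hcont
    (show (1 : ℝ) ∈ Set.Icc (φ 0) (φ lam⁻¹) from ⟨by rw [h0]; norm_num, h1.le⟩)
  have hm0 : 0 < m := lt_of_le_of_ne hm.1 fun h => by rw [← h, h0] at hφ; norm_num at hφ
  have hm1 : m < lam⁻¹ := lt_of_le_of_ne hm.2 fun h => by rw [h] at hφ; linarith
  refine ⟨m⁻¹, (lt_inv_comm₀ hm0 hlam).1 hm1, by rw [inv_inv]; exact hφ, fun s hs hs1 => ?_⟩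
  have hs0 : 0 < s⁻¹ := inv_pos.2 hs
  rw [← inv_inv s]
  congr 1
  rcases lt_trichotomy s⁻¹ m with h | h | h
  · have := hmono _ _ hs0.le h
    exact absurd (show φ s⁻¹ = 1 from hs1) (by linarith)
  · exact h
  · have := hmono _ _ hm0.le h
    exact absurd (show φ s⁻¹ = 1 from hs1) (by linarith)

/-- The two forms differ by the factor `t`, using `γ N = P`. -/
theorem isEffectiveRidge_iff {P : ℕ} (hN : 0 < N) (hP : 0 < P) {G : Matrix (Fin N) (Fin N) ℝ}
    (hG : G.IsHermitian) {γ t : ℝ} (hγ : γ = (P : ℝ) / N) :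
    IsEffectiveRidge hG lam γ t ↔
      0 < t ∧ lam * t⁻¹ + 1 / (P : ℝ) * ∑ k, satur (hG.eigenvalues k) t⁻¹ = 1 := by
  have hN0 : (0 : ℝ) < N := by exact_mod_cast hN
  have hP0 : (0 : ℝ) < P := by exact_mod_cast hP
  refine and_congr_right fun ht => ?_
  simp only [satur_inv ht]
  set S := ∑ k, hG.eigenvalues k / (t + hG.eigenvalues k)
  have e : lam + t / γ * (1 / (N : ℝ) * S) = t * (lam * t⁻¹ + 1 / (P : ℝ) * S) := by
    rw [hγ]; field_simp
  rw [e]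
  constructor
  · intro h
    exact (mul_right_eq_self₀.1 h.symm).resolve_right ht.ne'
  · intro h
    rw [h, mul_one]

end EffectiveRidge

/-! ### Linear functionals of the Gaussian features -/

section Features

variable {d P : ℕ} {K : Pt d → Pt d → ℝ} {Ω : Type*} [MeasurableSpace Ω] {π : Measure Ω}
  {f : Fin P → Pt d → Ω → ℝ}

theorem IsGaussianFeatures.hasGaussianLaw_apply (hf : IsGaussianFeatures K π f) (j : Fin P)
    (x : Pt d) : HasGaussianLaw (f j x) π :=
  (hf.gaussian j).hasGaussianLaw_eval x

/-- Each process is Gaussian on the finite set of points involved; independence in `j` makes these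
vectors jointly Gaussian, and the family is a projection of them. -/
theorem IsGaussianFeatures.hasGaussianLaw_family {κ : Type*} [Fintype κ]
    (hf : IsGaussianFeatures K π f) (q : κ → Fin P × Pt d) :
    HasGaussianLaw (fun ω k => f (q k).1 (q k).2 ω) π := by
  classical
  let I : Finset (Pt d) := Finset.univ.image fun k => (q k).2
  have h := iIndepFun.hasGaussianLaw (X := fun (j : Fin P) ω => I.restrict (f j · ω))
    (fun j => (hf.gaussian j).hasGaussianLaw I)
    (hf.indep.comp (fun _ u => I.restrict u) fun _ => by fun_prop)
  exact h.map_fun (ContinuousLinearMap.pi fun k =>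
    (ContinuousLinearMap.proj (R := ℝ) (φ := fun _ : I => ℝ)
      ⟨(q k).2, Finset.mem_image_of_mem _ (Finset.mem_univ k)⟩).comp
        (ContinuousLinearMap.proj (R := ℝ) (φ := fun _ : Fin P => I → ℝ) (q k).1))

theorem IsGaussianFeatures.hasGaussianLaw_sum {κ T : Type*} [Fintype κ] [Fintype T]
    (hf : IsGaussianFeatures K π f) (q : T → κ → Fin P × Pt d) (a : T → κ → ℝ) :
    HasGaussianLaw (fun ω t => ∑ k, a t k * f (q t k).1 (q t k).2 ω) π := by
  have h := (hf.hasGaussianLaw_family fun p : T × κ => q p.1 p.2).map_fun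
    (ContinuousLinearMap.pi fun t => ∑ k, a t k •
      ContinuousLinearMap.proj (R := ℝ) (φ := fun _ : T × κ => ℝ) (t, k))
  simpa using! h

theorem IsGaussianFeatures.memLp (hf : IsGaussianFeatures K π f) (j : Fin P) (x : Pt d) :
    MemLp (f j x) 2 π :=
  (hf.hasGaussianLaw_apply j x).memLp_two

theorem IsGaussianFeatures.covariance_eq [IsProbabilityMeasure π] (hf : IsGaussianFeatures K π f)
    (p p' : Fin P × Pt d) :
    cov[f p.1 p.2, f p'.1 p'.2; π] = if p.1 = p'.1 then K p.2 p'.2 else 0 := by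
  split_ifs with h
  · rw [covariance_eq_sub (hf.memLp _ _) (hf.memLp _ _), hf.mean, hf.mean, mul_zero, sub_zero, h]
    exact hf.cov _ _ _
  · exact ((hf.indep.indepFun h).comp (measurable_pi_apply p.2)
      (measurable_pi_apply p'.2)).covariance_eq_zero (hf.memLp _ _) (hf.memLp _ _)

theorem IsGaussianFeatures.covariance_sum [IsProbabilityMeasure π] {κ κ' : Type*} [Fintype κ]
    [Fintype κ'] (hf : IsGaussianFeatures K π f) (q : κ → Fin P × Pt d) (a : κ → ℝ)
    (q' : κ' → Fin P × Pt d) (a' : κ' → ℝ) :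
    cov[fun ω => ∑ k, a k * f (q k).1 (q k).2 ω, fun ω => ∑ k, a' k * f (q' k).1 (q' k).2 ω; π]
      = ∑ k, ∑ l, a k * (a' l * if (q k).1 = (q' l).1 then K (q k).2 (q' l).2 else 0) := by
  rw [covariance_fun_sum_fun_sum (fun k => (hf.memLp _ _).const_mul _)
    (fun k => (hf.memLp _ _).const_mul _)]
  simp only [covariance_const_mul_left, covariance_const_mul_right, hf.covariance_eq,
    mul_left_comm]

theorem IsGaussianFeatures.integral_sum {κ : Type*} [Fintype κ]
    (hf : IsGaussianFeatures K π f) (q : κ → Fin P × Pt d) (a : κ → ℝ) :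
    ∫ ω, ∑ k, a k * f (q k).1 (q k).2 ω ∂π = 0 := by
  rw [integral_finsetSum _ fun k _ =>
    ((hf.hasGaussianLaw_apply _ _).integrable).const_mul _]
  simp [integral_const_mul, hf.mean]

/-- A family of linear functionals of the features with identity covariance is a standard Gaussian
vector. -/
theorem IsGaussianFeatures.map_eq_stdGaussianPi [IsProbabilityMeasure π] {κ T : Type*} [Fintype κ]
    [Fintype T] [DecidableEq T] (hf : IsGaussianFeatures K π f) (q : T → κ → Fin P × Pt d)
    (a : T → κ → ℝ)
    (hcov : ∀ s t, ∑ k, ∑ l, a s k *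
      (a t l * if (q s k).1 = (q t l).1 then K (q s k).2 (q t l).2 else 0)
        = if s = t then 1 else 0) :
    π.map (fun ω t => ∑ k, a t k * f (q t k).1 (q t k).2 ω) = stdGaussianPi T := by
  have h := hf.hasGaussianLaw_sum q a
  have hind := h.iIndepFun_of_covariance_eq_zero fun s t hst => by
    rw [hf.covariance_sum, hcov, if_neg hst]
  rw [hind.map_fun_eq_pi_map fun t => (h.eval t).aemeasurable, stdGaussianPi]
  congr 1
  ext1 t
  rw [(h.eval t).map_eq_gaussianReal, hf.integral_sum,
    ← covariance_self (h.eval t).aemeasurable, hf.covariance_sum, hcov, if_pos rfl, Real.toNNReal_one]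

/-- The regression residual of `f j x` on the values at the data points is independent of all the
values at the data points. -/
theorem IsGaussianFeatures.indepFun_residual [IsProbabilityMeasure π] {N : ℕ}
    (hf : IsGaussianFeatures K π f) (X : Fin N → Pt d) (x : Pt d) (β : Fin N → ℝ)
    (hβ : ∀ i, K x (X i) = ∑ l, β l * K (X l) (X i)) (j : Fin P) :
    IndepFun (fun ω => f j x ω - ∑ i, β i * f j (X i) ω) (fun ω j i => f j (X i) ω) π := by
  -- The residual and all data values form one family of linear functionals, so that joint
  -- Gaussianity comes for free. `none` stands for `x` with weight `1` and `some i` for `X i` with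
  -- weight `-β i`; for a data value only `none` has a nonzero weight.
  let q : Unit ⊕ (Fin P × Fin N) → Option (Fin N) → Fin P × Pt d :=
    Sum.elim (fun _ o => (j, o.elim x X)) (fun p _ => (p.1, X p.2))
  let a : Unit ⊕ (Fin P × Fin N) → Option (Fin N) → ℝ :=
    Sum.elim (fun _ o => o.elim 1 (fun i => -β i)) (fun p o => o.elim 1 fun _ => 0)
  have h := (hf.hasGaussianLaw_sum q a).map_fun
    (ContinuousLinearMap.prod
      (ContinuousLinearMap.pi fun u : Unit =>
        ContinuousLinearMap.proj (R := ℝ) (φ := fun _ : Unit ⊕ (Fin P × Fin N) => ℝ) (Sum.inl u))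
      (ContinuousLinearMap.pi fun p : Fin P × Fin N =>
        ContinuousLinearMap.proj (R := ℝ) (φ := fun _ : Unit ⊕ (Fin P × Fin N) => ℝ) (Sum.inr p)))
  have hind := HasGaussianLaw.indepFun_of_covariance_eval
    (X := fun (u : Unit) ω => ∑ k, a (Sum.inl u) k * f (q (Sum.inl u) k).1 (q (Sum.inl u) k).2 ω)
    (Y := fun (p : Fin P × Fin N) ω =>
      ∑ k, a (Sum.inr p) k * f (q (Sum.inr p) k).1 (q (Sum.inr p) k).2 ω) h
    (fun u p => by
      rw [hf.covariance_sum]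
      by_cases hj : j = p.1
      -- The covariance is `K(x, xᵢ) - ∑ β_l K(x_l, xᵢ)`, zero by the choice of `β`; distinct
      -- features are uncorrelated.
      · simp [q, a, Fintype.sum_option, hj, hβ p.2]
      · simp [q, a, hj])
  have hu : Measurable fun u : Unit → ℝ => u () := measurable_pi_apply _
  have hcomp := hind.comp (φ := fun u : Unit → ℝ => u ()) (ψ := fun v (j : Fin P) (i : Fin N) => v (j, i))
    hu (by fun_prop)
  convert! hcomp using 1
  · ext ω
    simp [q, a, Fintype.sum_option, sub_eq_add_neg]
  · ext ω j i
    simp [q, a, Fintype.sum_option]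

end Features

/-! ### The averaged random feature predictor -/

section Predictor

variable {d N P : ℕ} {lam : ℝ}

theorem dataMatrix_mul_transpose_add (φ : Fin P → Pt d → ℝ) (X : Fin N → Pt d) :
    dataMatrix φ X * (dataMatrix φ X)ᵀ + lam • (1 : Matrix (Fin N) (Fin N) ℝ)
      = regMoment lam (fun _ : Fin P => 1 / (P : ℝ)) fun j i => φ j (X i) := by
  have hs : 1 / √(P : ℝ) * (1 / √(P : ℝ)) = 1 / (P : ℝ) := by
    rw [div_mul_div_comm, Real.mul_self_sqrt (Nat.cast_nonneg P), one_mul]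
  ext i l
  simp only [regMoment, Matrix.add_apply, Matrix.mul_apply, Matrix.transpose_apply, dataMatrix,
    Matrix.of_apply, Matrix.sum_apply, Matrix.smul_apply, Matrix.vecMulVec_apply, smul_eq_mul]
  rw [add_comm]
  congr 1
  exact Finset.sum_congr rfl fun j _ => by rw [← hs]; ring

/-- The optimal parameter as a function of the values of the features at the data points. -/
noncomputable def thetaOf (P : ℕ) (y : Fin N → ℝ) (lam : ℝ) (v : Fin P → Fin N → ℝ) : Fin P → ℝ :=
  fun j => 1 / √(P : ℝ) * (v j ⬝ᵥ (regMoment lam (fun _ : Fin P => 1 / (P : ℝ)) v)⁻¹ *ᵥ y)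

theorem thetaHat_eq_thetaOf (φ : Fin P → Pt d → ℝ) (X : Fin N → Pt d) (y : Fin N → ℝ) :
    thetaHat φ X y lam = thetaOf P y lam fun j i => φ j (X i) := by
  ext j
  rw [thetaHat, thetaOf, dataMatrix_mul_transpose_add]
  simp only [Matrix.mulVec, dotProduct, Matrix.transpose_apply, dataMatrix, Matrix.of_apply,
    Finset.mul_sum (a := 1 / √(P : ℝ)), mul_assoc]

theorem measurable_thetaOf (hlam : 0 < lam) (y : Fin N → ℝ) (j : Fin P) :
    Measurable fun v => thetaOf P y lam v j := by
  have h : ∀ a b, Continuous fun v : Fin P → Fin N → ℝ =>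
      (regMoment lam (fun _ : Fin P => 1 / (P : ℝ)) v)⁻¹ a b := fun a b =>
    continuous_resolvent_apply hlam (fun _ => by positivity) a b
  have hc : Continuous fun v => thetaOf P y lam v j := by
    simp only [thetaOf, dotProduct, Matrix.mulVec]
    refine continuous_const.mul (continuous_finsetSum _ fun i _ => ?_)
    refine (show Continuous fun v : Fin P → Fin N → ℝ => v j i by fun_prop).mul
      (continuous_finsetSum _ fun b _ => ?_)
    exact (h i b).mul continuous_const
  exact hc.measurable

/-- The minimizer does no worse than `θ = 0`, whose loss is the mean of `y i ^ 2`. This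
deterministic bound gives all the integrability of the predictor. -/
theorem abs_thetaHat_le (hN : 0 < N) (hlam : 0 < lam) (φ : Fin P → Pt d → ℝ) (X : Fin N → Pt d)
    (y : Fin N → ℝ) (j : Fin P) : |thetaHat φ X y lam j| ≤ √((∑ i, y i ^ 2) / lam) := by
  have hN0 : (0 : ℝ) < N := by exact_mod_cast hN
  have hloss : ridgeLoss φ X y lam (thetaHat φ X y lam) ≤ ridgeLoss φ X y lam 0 := by
    by_cases h : (0 : Fin P → ℝ) = thetaHat φ X y lam
    · rw [← h]
    · exact (ridgeLoss_thetaHat_lt hN φ X y hlam 0 h).le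
  have h0 : ridgeLoss φ X y lam 0 = 1 / (N : ℝ) * ∑ i, y i ^ 2 := by
    simp [ridgeLoss, linModel]
  have h1 : lam / N * ∑ j, thetaHat φ X y lam j ^ 2 ≤ ridgeLoss φ X y lam (thetaHat φ X y lam) :=
    le_add_of_nonneg_left (mul_nonneg (by positivity) (Finset.sum_nonneg fun _ _ => sq_nonneg _))
  have h2 : thetaHat φ X y lam j ^ 2 ≤ ∑ j, thetaHat φ X y lam j ^ 2 :=
    Finset.single_le_sum (f := fun j => thetaHat φ X y lam j ^ 2) (fun _ _ => sq_nonneg _)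
      (Finset.mem_univ j)
  refine Real.abs_le_sqrt (h2.trans ?_)
  rw [le_div_iff₀ hlam]
  have h3 := (h1.trans hloss).trans_eq h0
  rw [div_mul_eq_mul_div, one_div_mul_eq_div, div_le_div_iff_of_pos_right hN0] at h3
  linarith

variable {K : Pt d → Pt d → ℝ} {Ω : Type*} [MeasurableSpace Ω] {π : Measure Ω}
  [IsProbabilityMeasure π] {f : Fin P → Pt d → Ω → ℝ}

omit [IsProbabilityMeasure π] in
theorem IsGaussianFeatures.measurable_thetaHat (hf : IsGaussianFeatures K π f) (hlam : 0 < lam)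
    (X : Fin N → Pt d) (y : Fin N → ℝ) (j : Fin P) :
    Measurable fun ω => thetaHat (fun j z => f j z ω) X y lam j := by
  simp only [thetaHat_eq_thetaOf]
  have hv : Measurable fun ω (j : Fin P) (i : Fin N) => f j (X i) ω :=
    measurable_pi_lambda _ fun j => measurable_pi_lambda _ fun i => hf.measurable j (X i)
  exact (measurable_thetaOf hlam y j).comp hv

omit [IsProbabilityMeasure π] in
theorem IsGaussianFeatures.integrable_thetaHat_mul (hf : IsGaussianFeatures K π f) (hN : 0 < N)
    (hlam : 0 < lam) (X : Fin N → Pt d) (y : Fin N → ℝ) (j : Fin P) {g : Ω → ℝ}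
    (hg : Integrable g π) :
    Integrable (fun ω => thetaHat (fun j z => f j z ω) X y lam j * g ω) π :=
  hg.bdd_mul (hf.measurable_thetaHat hlam X y j).aestronglyMeasurable
    (Filter.Eventually.of_forall fun _ => abs_thetaHat_le hN hlam _ X y j)

omit [IsProbabilityMeasure π] in
theorem IsGaussianFeatures.integrable_rfPredictor (hf : IsGaussianFeatures K π f) (hN : 0 < N)
    (hlam : 0 < lam) (X : Fin N → Pt d) (y : Fin N → ℝ) (x : Pt d) :
    Integrable (fun ω => rfPredictor f X y lam ω x) π :=
  (integrable_finsetSum _ fun j _ => hf.integrable_thetaHat_mul hN hlam X y j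
    (hf.hasGaussianLaw_apply j x).integrable).const_mul _

/-- The averaged predictor at `x` is the linear regression of its values at the data points. -/
theorem IsGaussianFeatures.avgRFPredictor_eq_sum (hf : IsGaussianFeatures K π f) (hN : 0 < N)
    (hlam : 0 < lam) (X : Fin N → Pt d) (y : Fin N → ℝ) (x : Pt d) (β : Fin N → ℝ)
    (hβ : ∀ i, K x (X i) = ∑ l, β l * K (X l) (X i)) :
    avgRFPredictor π f X y lam x = ∑ i, β i * avgRFPredictor π f X y lam (X i) := by
  let θ : Fin P → Ω → ℝ := fun j ω => thetaHat (fun j z => f j z ω) X y lam j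
  let r : Fin P → Ω → ℝ := fun j ω => f j x ω - ∑ i, β i * f j (X i) ω
  have hint : ∀ j z, Integrable (f j z) π := fun j z => (hf.hasGaussianLaw_apply j z).integrable
  have hsumint : ∀ j, Integrable (fun ω => ∑ i, β i * f j (X i) ω) π := fun j =>
    integrable_finsetSum _ fun i _ => (hint j (X i)).const_mul _
  have hr : ∀ j, Integrable (r j) π := fun j => (hint j x).sub (hsumint j)
  -- `θ̂` is a function of the data values, hence independent of the centered residual.
  have hθr : ∀ j, ∫ ω, θ j ω * r j ω ∂π = 0 := fun j => by
    have hind := (hf.indepFun_residual X x β hβ j).comp measurable_id (measurable_thetaOf hlam y j)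
    have hind' : IndepFun (θ j) (r j) π := by
      have e : θ j = (fun v => thetaOf P y lam v j) ∘ fun ω j i => f j (X i) ω := by
        ext ω; simp only [θ, thetaHat_eq_thetaOf, Function.comp_apply]
      rw [e]
      exact hind.symm
    have hr0 : ∫ ω, r j ω ∂π = 0 := by
      rw [integral_sub (hint j x) (hsumint j),
        integral_finsetSum _ fun i _ => (hint j (X i)).const_mul _]
      simp [integral_const_mul, hf.mean]
    rw [hind'.integral_fun_mul_eq_mul_integral
      (hf.measurable_thetaHat hlam X y j).aestronglyMeasurable (hr j).aestronglyMeasurable, hr0,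
      mul_zero]
  have hpt : ∀ ω, rfPredictor f X y lam ω x
      = 1 / √(P : ℝ) * ∑ j, θ j ω * r j ω + ∑ i, β i * rfPredictor f X y lam ω (X i) := fun ω => by
    have h1 : ∑ i, β i * rfPredictor f X y lam ω (X i)
        = 1 / √(P : ℝ) * ∑ j, θ j ω * ∑ i, β i * f j (X i) ω := by
      simp only [rfPredictor, linModel, Finset.mul_sum]
      rw [Finset.sum_comm]
      exact Finset.sum_congr rfl fun j _ => Finset.sum_congr rfl fun i _ => by ring
    rw [h1, ← mul_add, ← Finset.sum_add_distrib, rfPredictor, linModel]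
    congr 1
    exact Finset.sum_congr rfl fun j _ => by simp only [θ, r]; ring
  have hθrint := fun j => hf.integrable_thetaHat_mul hN hlam X y j (hr j)
  simp only [avgRFPredictor]
  simp only [hpt]
  rw [integral_add ((integrable_finsetSum _ fun j _ => hθrint j).const_mul _)
    (integrable_finsetSum _ fun i _ => (hf.integrable_rfPredictor hN hlam X y (X i)).const_mul _),
    integral_const_mul, integral_finsetSum _ fun j _ => hθrint j,
    integral_finsetSum _ fun i _ => (hf.integrable_rfPredictor hN hlam X y (X i)).const_mul _]
  simp only [integral_const_mul]
  rw [Finset.sum_eq_zero fun j _ => hθr j, mul_zero, zero_add]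

/-- The push-through identity `Fᵀ (F Fᵀ + λ)⁻¹ = (Fᵀ F + λ)⁻¹ Fᵀ`. -/
theorem transpose_mulVec_inv_mulVec (hlam : 0 < lam) (F : Matrix (Fin N) (Fin P) ℝ)
    (y : Fin N → ℝ) :
    Fᵀ *ᵥ ((F * Fᵀ + lam • (1 : Matrix (Fin N) (Fin N) ℝ))⁻¹ *ᵥ y)
      = (Fᵀ * F + lam • (1 : Matrix (Fin P) (Fin P) ℝ))⁻¹ *ᵥ (Fᵀ *ᵥ y) := by
  have h1 : (F * Fᵀ + lam • (1 : Matrix (Fin N) (Fin N) ℝ)).PosDef :=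
    Matrix.PosDef.posSemidef_add (by simpa using Matrix.posSemidef_self_mul_conjTranspose F)
      (Matrix.PosDef.one.smul hlam)
  have h2 : (Fᵀ * F + lam • (1 : Matrix (Fin P) (Fin P) ℝ)).PosDef :=
    Matrix.PosDef.posSemidef_add (by simpa using Matrix.posSemidef_conjTranspose_mul_self F)
      (Matrix.PosDef.one.smul hlam)
  have hu1 := (Matrix.isUnit_iff_isUnit_det _).1 h1.isUnit
  have hu2 := (Matrix.isUnit_iff_isUnit_det _).1 h2.isUnit
  have hc : Fᵀ * (F * Fᵀ + lam • (1 : Matrix (Fin N) (Fin N) ℝ))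
      = (Fᵀ * F + lam • (1 : Matrix (Fin P) (Fin P) ℝ)) * Fᵀ := by
    rw [Matrix.mul_add, Matrix.add_mul, Matrix.mul_assoc, Matrix.mul_smul, Matrix.smul_mul,
      Matrix.mul_one, Matrix.one_mul]
  set v := (F * Fᵀ + lam • (1 : Matrix (Fin N) (Fin N) ℝ))⁻¹ *ᵥ y with hv
  have hy : y = (F * Fᵀ + lam • (1 : Matrix (Fin N) (Fin N) ℝ)) *ᵥ v := by
    rw [hv, Matrix.mulVec_mulVec, Matrix.mul_nonsing_inv _ hu1, Matrix.one_mulVec]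
  rw [hy, Matrix.mulVec_mulVec v, hc, ← Matrix.mulVec_mulVec v, Matrix.mulVec_mulVec (Fᵀ *ᵥ v),
    Matrix.nonsing_inv_mul _ hu2, Matrix.one_mulVec]

/-- The fitted values `F θ̂` when `F = ∑ₖ uₖ √cₖ wₖᵀ`, in terms of the resolvent. -/
theorem mulVec_thetaHat_eq (hlam : 0 < lam) {U : Matrix (Fin N) (Fin N) ℝ} (hU : Uᵀ * U = 1)
    {c : Fin N → ℝ} (hc : ∀ k, 0 ≤ c k) (x : Fin N × Fin P → ℝ) {F : Matrix (Fin N) (Fin P) ℝ}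
    (hF : ∀ i j, F i j = ∑ k, U i k * (√(c k) * x (k, j))) (y : Fin N → ℝ) (i : Fin N) :
    (F *ᵥ (Fᵀ *ᵥ ((F * Fᵀ + lam • (1 : Matrix (Fin N) (Fin N) ℝ))⁻¹ *ᵥ y))) i
      = ∑ k, ∑ l, U i k * (√(c k) * √(c l) * (rows x k ⬝ᵥ resolvent lam c x *ᵥ rows x l))
          * (Uᵀ *ᵥ y) l := by
  let Wt : Matrix (Fin N) (Fin P) ℝ := Matrix.of fun k j => √(c k) * x (k, j)
  have hFW : F = U * Wt := by
    ext i j; simp [hF, Matrix.mul_apply, Wt]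
  have hFF : Fᵀ * F + lam • (1 : Matrix (Fin P) (Fin P) ℝ) = regMoment lam c (rows x) := by
    rw [hFW, Matrix.transpose_mul, Matrix.mul_assoc, ← Matrix.mul_assoc Uᵀ, hU, Matrix.one_mul]
    ext a b
    simp only [regMoment, Matrix.add_apply, Matrix.mul_apply, Matrix.transpose_apply, Wt,
      Matrix.of_apply, Matrix.sum_apply, Matrix.smul_apply, Matrix.vecMulVec_apply, smul_eq_mul,
      rows]
    rw [add_comm]
    congr 1
    exact Finset.sum_congr rfl fun k _ => by
      rw [mul_mul_mul_comm, Real.mul_self_sqrt (hc k)]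
  have hFy : Fᵀ *ᵥ y = ∑ l, (√(c l) * (Uᵀ *ᵥ y) l) • rows x l := by
    rw [hFW, Matrix.transpose_mul, ← Matrix.mulVec_mulVec]
    ext a
    simp only [Matrix.mulVec, dotProduct, Matrix.transpose_apply, Wt, Matrix.of_apply,
      Finset.sum_apply, Pi.smul_apply, smul_eq_mul, rows]
    exact Finset.sum_congr rfl fun l _ => by ring
  rw [transpose_mulVec_inv_mulVec hlam, hFF, hFy, Matrix.mulVec_sum, hFW, ← Matrix.mulVec_mulVec]
  change ∑ k, U i k * (Wt *ᵥ _) k = _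
  refine Finset.sum_congr rfl fun k _ => ?_
  have hWk : ∀ v, (Wt *ᵥ v) k = √(c k) * (rows x k ⬝ᵥ v) := fun v => by
    simp only [Matrix.mulVec, dotProduct, Wt, Matrix.of_apply, Finset.mul_sum, rows, mul_assoc]
  rw [hWk, dotProduct_sum, Finset.mul_sum, Finset.mul_sum]
  refine Finset.sum_congr rfl fun l _ => ?_
  rw [Matrix.mulVec_smul, dotProduct_smul, smul_eq_mul, resolvent]
  ring

/-- Whitening the data values in the eigenbasis turns the features into independent standard
Gaussian rows; of the double sum in `mulVec_thetaHat_eq` only the diagonal survives the expectation.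
-/
theorem IsGaussianFeatures.avgRFPredictor_data_eq (hf : IsGaussianFeatures K π f) (hP : 0 < P)
    (hlam : 0 < lam) (X : Fin N → Pt d) (y : Fin N → ℝ) {U : Matrix (Fin N) (Fin N) ℝ}
    (hU : Uᵀ * U = 1) {D : Fin N → ℝ} (hD : ∀ k, 0 < D k)
    (hG : gram K X = U * Matrix.diagonal D * Uᵀ) (i : Fin N) :
    avgRFPredictor π f X y lam (X i)
      = ∑ k, U i k * (∫ x : Fin N × Fin P → ℝ, D k / P *
          (rows x k ⬝ᵥ resolvent lam (fun k => D k / P) x *ᵥ rows x k)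
            ∂stdGaussianPi (Fin N × Fin P)) * (Uᵀ *ᵥ y) k := by
  have hP0 : (0 : ℝ) < P := by exact_mod_cast hP
  have hUU : U * Uᵀ = 1 := mul_eq_one_comm.1 hU
  set c : Fin N → ℝ := fun k => D k / P
  have hc : ∀ k, 0 ≤ c k := fun k => div_nonneg (hD k).le hP0.le
  -- The `k`-th eigencoordinate of the values of feature `j`, divided by its standard deviation `√(D
  -- k)`.
  let W : Ω → Fin N × Fin P → ℝ := fun ω p => ∑ i, (U i p.1 / √(D p.1)) * f p.2 (X i) ω
  have hWm : Measurable W := measurable_pi_lambda _ fun p =>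
    Finset.measurable_sum _ fun i _ => (hf.measurable _ _).const_mul _
  have hUGU : ∀ k l, ∑ a, ∑ b, U a k * (U b l * K (X a) (X b)) = if k = l then D k else 0 := by
    intro k l
    have h : Uᵀ * gram K X * U = Matrix.diagonal D := by
      rw [hG, mul_assoc, mul_assoc, hU, mul_one, ← mul_assoc, hU, one_mul]
    have h2 := congrFun (congrFun h k) l
    rw [Matrix.diagonal_apply] at h2
    rw [← h2, mul_assoc, Matrix.mul_apply]
    simp only [Matrix.mul_apply, Matrix.transpose_apply, gram, Matrix.of_apply, Finset.mul_sum]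
    exact Finset.sum_congr rfl fun a _ => Finset.sum_congr rfl fun b _ => by ring
  have hlaw : π.map W = stdGaussianPi (Fin N × Fin P) := by
    refine hf.map_eq_stdGaussianPi (fun (p : Fin N × Fin P) i => (p.2, X i))
      (fun p i => U i p.1 / √(D p.1)) ?_
    rintro ⟨k, j⟩ ⟨l, j'⟩
    by_cases hj : j = j'
    · subst hj
      have h : ∑ a, ∑ b, U a k / √(D k) * (U b l / √(D l) * K (X a) (X b))
          = (√(D k) * √(D l))⁻¹ * ∑ a, ∑ b, U a k * (U b l * K (X a) (X b)) := by
        simp only [Finset.mul_sum]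
        exact Finset.sum_congr rfl fun a _ => Finset.sum_congr rfl fun b _ => by
          rw [mul_inv]; ring
      simp only [if_true]
      rw [h, hUGU]
      by_cases hkl : k = l
      · subst hkl
        rw [if_pos rfl, if_pos rfl, Real.mul_self_sqrt (hD k).le, inv_mul_cancel₀ (hD k).ne']
      · simp [hkl]
    · simp [hj]
  have hF : ∀ ω i j, dataMatrix (fun j z => f j z ω) X i j
      = ∑ k, U i k * (√(c k) * W ω (k, j)) := by
    intro ω i j
    have hsq : ∀ k, √(c k) = √(D k) / √(P : ℝ) := fun k => Real.sqrt_div (hD k).le _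
    have h1 : ∀ k, U i k * (√(c k) * W ω (k, j))
        = 1 / √(P : ℝ) * ∑ l, U i k * U l k * f j (X l) ω := by
      intro k
      simp only [W, Finset.mul_sum]
      refine Finset.sum_congr rfl fun l _ => ?_
      have := (Real.sqrt_pos.2 (hD k)).ne'
      rw [hsq]; field_simp
    simp only [h1]
    rw [← Finset.mul_sum, Finset.sum_comm]
    simp only [← Finset.sum_mul]
    have h2 : ∀ l, ∑ k, U i k * U l k = if i = l then 1 else 0 := fun l => by
      have := congrFun (congrFun hUU i) l
      rwa [Matrix.mul_apply, Matrix.one_apply] at this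
    simp [h2, dataMatrix]
  have hpt : ∀ ω, rfPredictor f X y lam ω (X i)
      = ∑ k, ∑ l, U i k * (√(c k) * √(c l) *
          (rows (W ω) k ⬝ᵥ resolvent lam c (W ω) *ᵥ rows (W ω) l)) * (Uᵀ *ᵥ y) l := fun ω => by
    rw [← mulVec_thetaHat_eq hlam hU hc (W ω) (hF ω) y i]
    simp only [rfPredictor, linModel, thetaHat, Matrix.mulVec, dotProduct, dataMatrix,
      Matrix.of_apply, Finset.mul_sum (a := 1 / √(P : ℝ))]
    exact Finset.sum_congr rfl fun j _ => by ring
  have hint := fun k l => ((integrable_rows_resolvent (P := P) hlam hc k l).const_mul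
    (√(c k) * √(c l))).const_mul (U i k) |>.mul_const ((Uᵀ *ᵥ y) l)
  have hmeas : Integrable (fun x : Fin N × Fin P → ℝ => ∑ k, ∑ l, U i k * (√(c k) * √(c l) *
          (rows x k ⬝ᵥ resolvent lam c x *ᵥ rows x l)) * (Uᵀ *ᵥ y) l)
      (stdGaussianPi (Fin N × Fin P)) :=
    integrable_finsetSum _ fun k _ => integrable_finsetSum _ fun l _ => hint k l
  simp only [avgRFPredictor, hpt]
  rw [← integral_map (f := fun x : Fin N × Fin P → ℝ => ∑ k, ∑ l, U i k * (√(c k) * √(c l) *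
          (rows x k ⬝ᵥ resolvent lam c x *ᵥ rows x l)) * (Uᵀ *ᵥ y) l) hWm.aemeasurable
    (by rw [hlaw]; exact hmeas.aestronglyMeasurable), hlaw,
    integral_finsetSum _ fun k _ => integrable_finsetSum _ fun l _ => hint k l]
  refine Finset.sum_congr rfl fun k _ => ?_
  rw [integral_finsetSum _ fun l _ => hint k l]
  simp only [integral_mul_const, integral_const_mul]
  rw [Finset.sum_eq_single k]
  · rw [Real.mul_self_sqrt (hc k)]
  · intro l _ hl
    rw [integral_rows_resolvent_of_ne (Ne.symm hl)]
    simp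
  · simp

end Predictor

/-! ### Comparison of the predictors -/

/-- Expand the square; the cross term is at most `2 A ‖u‖` by Cauchy–Schwarz in `L²`. -/
theorem abs_integral_sq_sub_le {E : Type*} [MeasurableSpace E] {μ : Measure E} {δ u : E → ℝ}
    (hδ : MemLp δ 2 μ) (hu : MemLp u 2 μ) {A : ℝ} (hA : 0 ≤ A) (hδA : ∫ x, δ x ^ 2 ∂μ ≤ A ^ 2) :
    |∫ x, (δ x + u x) ^ 2 ∂μ - ∫ x, u x ^ 2 ∂μ| ≤ A * (2 * √(∫ x, u x ^ 2 ∂μ) + A) := by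
  have hδu : Integrable (fun x => δ x * u x) μ := hδ.integrable_mul hu
  have hsum : ∫ x, (δ x + u x) ^ 2 ∂μ
      = ∫ x, δ x ^ 2 ∂μ + 2 * ∫ x, δ x * u x ∂μ + ∫ x, u x ^ 2 ∂μ := by
    rw [← integral_const_mul, ← integral_add hδ.integrable_sq (hδu.const_mul 2),
      ← integral_add (by exact hδ.integrable_sq.add (hδu.const_mul 2)) hu.integrable_sq]
    exact integral_congr_ae (Filter.Eventually.of_forall fun x => by simp only; ring)
  have hCS : |∫ x, δ x * u x ∂μ| ≤ √(∫ x, δ x ^ 2 ∂μ) * √(∫ x, u x ^ 2 ∂μ) := by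
    have h := integral_mul_le_Lp_mul_Lq_of_nonneg (μ := μ) Real.HolderConjugate.two_two
      (f := fun x => |δ x|) (g := fun x => |u x|)
      (Filter.Eventually.of_forall fun x => abs_nonneg _)
      (Filter.Eventually.of_forall fun x => abs_nonneg _)
      (by simpa using! hδ.abs) (by simpa using! hu.abs)
    simp only [Real.rpow_two, sq_abs, ← Real.sqrt_eq_rpow, ← abs_mul] at h
    exact (abs_integral_le_integral_abs).trans h
  have hδ0 : 0 ≤ ∫ x, δ x ^ 2 ∂μ := integral_nonneg fun x => sq_nonneg _
  have hsq : √(∫ x, δ x ^ 2 ∂μ) ≤ A := by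
    rw [← Real.sqrt_sq hA]; exact Real.sqrt_le_sqrt hδA
  rw [hsum, add_sub_cancel_right]
  calc |∫ x, δ x ^ 2 ∂μ + 2 * ∫ x, δ x * u x ∂μ|
      ≤ |∫ x, δ x ^ 2 ∂μ| + |2 * ∫ x, δ x * u x ∂μ| := abs_add_le _ _
    _ ≤ A ^ 2 + 2 * (A * √(∫ x, u x ^ 2 ∂μ)) := by
        rw [abs_of_nonneg hδ0, abs_mul, abs_two]
        gcongr
        exact hCS.trans (mul_le_mul_of_nonneg_right hsq (Real.sqrt_nonneg _))
    _ = _ := by ring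

/-! ### Kernel inequalities and diagonalization of the Gram matrix. -/

section Kernel

variable {d N : ℕ} {K : Pt d → Pt d → ℝ}

theorem IsKernel.diag_nonneg (hK : IsKernel K) (x : Pt d) : 0 ≤ K x x := by
  simpa [gram] using (hK.posSemidef 1 fun _ => x).diag_nonneg (i := 0)

/-- Nonnegativity of the `2 × 2` Gram determinant. -/
theorem IsKernel.sq_le (hK : IsKernel K) (x z : Pt d) : K x z ^ 2 ≤ K x x * K z z := by
  have h := (hK.posSemidef 2 ![x, z]).det_nonneg
  rw [Matrix.det_fin_two] at h
  simp only [gram, Matrix.of_apply, Matrix.cons_val_zero, Matrix.cons_val_one] at h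
  rw [hK.symm z x] at h
  linarith

/-- The Gram form of the `N + 1` points `x, x₁, …, x_N` at the vector `(1, -β)` is the variance of
the regression residual, `K(x, x) - β · G β`, hence nonnegative. -/
theorem IsKernel.quad_le (hK : IsKernel K) (X : Fin N → Pt d) (x : Pt d) (β : Fin N → ℝ)
    (hβ : ∀ i, K x (X i) = (gram K X *ᵥ β) i) : β ⬝ᵥ gram K X *ᵥ β ≤ K x x := by
  have h := (hK.posSemidef (N + 1) (Fin.cons x X)).dotProduct_mulVec_nonneg (Fin.cons 1 (-β))
  simp only [dotProduct, Matrix.mulVec, gram, Matrix.of_apply, Fin.sum_univ_succ, Fin.cons_zero,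
    Fin.cons_succ, star_trivial, Pi.neg_apply] at h
  have h1 : ∑ i, K x (X i) * -β i = -(β ⬝ᵥ gram K X *ᵥ β) := by
    simp only [hβ, dotProduct]
    rw [← Finset.sum_neg_distrib]
    exact Finset.sum_congr rfl fun i _ => by ring
  have h2 : ∑ i, -β i * (K (X i) x * 1 + ∑ l, K (X i) (X l) * -β l) = 0 := by
    refine Finset.sum_eq_zero fun i _ => ?_
    have : ∑ l, K (X i) (X l) * -β l = -K x (X i) := by
      rw [hβ i]
      simp [Matrix.mulVec, dotProduct, gram]
    rw [this, hK.symm (X i) x]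
    ring
  rw [h1, h2] at h
  linarith

theorem IsKernel.memLp_apply (hK : IsKernel K) {D : Measure (Pt d)}
    (hm : Measurable (Function.uncurry K)) (hint : Integrable (fun x => K x x) D) (z : Pt d) :
    MemLp (fun x => K x z) 2 D := by
  have hmz : Measurable fun x => K x z := hm.comp (measurable_id.prodMk measurable_const)
  refine (memLp_two_iff_integrable_sq hmz.aestronglyMeasurable).2
    ((hint.mul_const (K z z)).mono' (hmz.pow_const 2).aestronglyMeasurable
      (Filter.Eventually.of_forall fun x => ?_))
  rw [Real.norm_eq_abs, abs_of_nonneg (sq_nonneg _)]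
  exact hK.sq_le x z

variable {U : Matrix (Fin N) (Fin N) ℝ} {D : Fin N → ℝ} {X : Fin N → Pt d}

theorem inv_conj_diagonal (hU : Uᵀ * U = 1) (hD : ∀ k, 0 < D k) :
    (U * Matrix.diagonal D * Uᵀ)⁻¹ = U * Matrix.diagonal (fun k => (D k)⁻¹) * Uᵀ := by
  refine Matrix.inv_eq_right_inv ?_
  have hUU : U * Uᵀ = 1 := mul_eq_one_comm.1 hU
  have hDD : Matrix.diagonal D * Matrix.diagonal (fun k => (D k)⁻¹) = 1 := by
    rw [Matrix.diagonal_mul_diagonal, ← Matrix.diagonal_one]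
    congr 1
    ext k
    exact mul_inv_cancel₀ (hD k).ne'
  calc U * Matrix.diagonal D * Uᵀ * (U * Matrix.diagonal (fun k => (D k)⁻¹) * Uᵀ)
      = U * Matrix.diagonal D * (Uᵀ * U) * Matrix.diagonal (fun k => (D k)⁻¹) * Uᵀ := by
        simp only [Matrix.mul_assoc]
    _ = U * (Matrix.diagonal D * Matrix.diagonal (fun k => (D k)⁻¹)) * Uᵀ := by
        rw [hU, Matrix.mul_one, Matrix.mul_assoc U]
    _ = 1 := by rw [hDD, Matrix.mul_one, hUU]

theorem dotProduct_conj_diagonal (e u v : Fin N → ℝ) :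
    u ⬝ᵥ (U * Matrix.diagonal e * Uᵀ) *ᵥ v = ∑ k, (Uᵀ *ᵥ u) k * e k * (Uᵀ *ᵥ v) k := by
  rw [← Matrix.mulVec_mulVec, ← Matrix.mulVec_mulVec, Matrix.dotProduct_mulVec,
    ← Matrix.mulVec_transpose, dotProduct]
  exact Finset.sum_congr rfl fun k _ => by rw [Matrix.mulVec_diagonal]; ring

theorem krrPredictor_eq_sum (hU : Uᵀ * U = 1) (hD : ∀ k, 0 < D k)
    (hG : gram K X = U * Matrix.diagonal D * Uᵀ) (y : Fin N → ℝ) {t : ℝ} (ht : 0 < t) (x : Pt d)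
    (β : Fin N → ℝ) (hβ : ∀ i, K x (X i) = (gram K X *ᵥ β) i) :
    krrPredictor K X y t x = ∑ k, (Uᵀ *ᵥ β) k * satur (D k) t⁻¹ * (Uᵀ *ᵥ y) k := by
  have hUU : U * Uᵀ = 1 := mul_eq_one_comm.1 hU
  have hGt : gram K X + t • (1 : Matrix (Fin N) (Fin N) ℝ)
      = U * Matrix.diagonal (fun k => D k + t) * Uᵀ := by
    have h : Matrix.diagonal (fun k => D k + t)
        = Matrix.diagonal D + t • (1 : Matrix (Fin N) (Fin N) ℝ) := by
      rw [← Matrix.diagonal_one, ← Matrix.diagonal_smul, Matrix.diagonal_add]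
      simp
    rw [h, Matrix.mul_add, Matrix.add_mul, ← hG, Matrix.mul_smul, Matrix.smul_mul, Matrix.mul_one,
      hUU]
  have hk : (fun i => K x (X i)) = gram K X *ᵥ β := funext hβ
  rw [krrPredictor, hGt, inv_conj_diagonal hU fun k => add_pos (hD k) ht, dotProduct_conj_diagonal,
    hk, hG]
  have h2 : Uᵀ *ᵥ ((U * Matrix.diagonal D * Uᵀ) *ᵥ β) = Matrix.diagonal D *ᵥ (Uᵀ *ᵥ β) := by
    rw [Matrix.mulVec_mulVec, ← Matrix.mul_assoc, ← Matrix.mul_assoc, hU, Matrix.one_mul,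
      Matrix.mulVec_mulVec]
  refine Finset.sum_congr rfl fun k _ => ?_
  rw [h2, Matrix.mulVec_diagonal, satur_inv ht, add_comm (D k) t, div_eq_mul_inv]
  ring

/-- Cauchy–Schwarz after writing `|b v| = (√D |b|) (|v| / √D)`. These weights make the two factors
`√K(x, x)` and `‖y‖_{K⁻¹}` appear, with no condition number of the Gram matrix. -/
theorem abs_sum_le_of_abs_le {E : ℝ} (hD : ∀ k, 0 < D k) {b e v : Fin N → ℝ}
    (he : ∀ k, |e k| ≤ E) (hE : 0 ≤ E) :
    |∑ k, b k * e k * v k| ≤ E * √(∑ k, b k * D k * b k) * √(∑ k, v k * (D k)⁻¹ * v k) := by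
  have h1 : |∑ k, b k * e k * v k| ≤ E * ∑ k, |b k| * |v k| := by
    rw [Finset.mul_sum]
    refine (Finset.abs_sum_le_sum_abs _ _).trans (Finset.sum_le_sum fun k _ => ?_)
    rw [abs_mul, abs_mul, mul_comm |b k|, mul_assoc]
    exact mul_le_mul_of_nonneg_right (he k) (by positivity)
  have h2 : (∑ k, |b k| * |v k|) ^ 2 ≤ (∑ k, b k * D k * b k) * ∑ k, v k * (D k)⁻¹ * v k :=
    Finset.sum_sq_le_sum_mul_sum_of_sq_le_mul _
      (fun k _ => by have := (hD k).le; nlinarith [mul_nonneg this (mul_self_nonneg (b k))])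
      (fun k _ => by
        have := inv_nonneg.2 (hD k).le
        nlinarith [mul_nonneg this (mul_self_nonneg (v k))])
      (fun k _ => by
        rw [mul_pow, sq_abs, sq_abs]
        have := (hD k).ne'
        refine le_of_eq ?_
        field_simp)
  rw [mul_assoc, ← Real.sqrt_mul' _ (Finset.sum_nonneg fun k _ => by
    have := inv_nonneg.2 (hD k).le
    nlinarith [mul_nonneg this (mul_self_nonneg (v k))])]
  exact h1.trans (mul_le_mul_of_nonneg_left (Real.le_sqrt_of_sq_le h2) hE)

theorem exists_conj_diagonal {G : Matrix (Fin N) (Fin N) ℝ} (hG : G.IsHermitian) :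
    ∃ U : Matrix (Fin N) (Fin N) ℝ, Uᵀ * U = 1 ∧ G = U * Matrix.diagonal hG.eigenvalues * Uᵀ := by
  refine ⟨hG.eigenvectorUnitary, ?_, ?_⟩
  · exact Matrix.mem_unitaryGroup_iff'.1 hG.eigenvectorUnitary.2
  · have h := hG.spectral_theorem
    rw [Unitary.conjStarAlgAut_apply] at h
    exact h

end Kernel

/-! ### The pointwise bound and square integrability of the predictors. -/

section Comparison

variable {d N P : ℕ} {lam t : ℝ} {K : Pt d → Pt d → ℝ} {X : Fin N → Pt d}
  {Ω : Type*} [MeasurableSpace Ω] {π : Measure Ω} [IsProbabilityMeasure π]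
  {f : Fin P → Pt d → Ω → ℝ}

theorem gram_mulVec_inv (hG : (gram K X).PosDef) (v : Fin N → ℝ) :
    gram K X *ᵥ ((gram K X)⁻¹ *ᵥ v) = v := by
  rw [Matrix.mulVec_mulVec, Matrix.mul_nonsing_inv _ ((Matrix.isUnit_iff_isUnit_det _).1 hG.isUnit),
    Matrix.one_mulVec]

theorem regression_weights_eq (hK : IsKernel K) {x : Pt d} {β : Fin N → ℝ}
    (hβ : ∀ i, K x (X i) = (gram K X *ᵥ β) i) (i : Fin N) :
    K x (X i) = ∑ l, β l * K (X l) (X i) := by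
  rw [hβ i]
  simp only [Matrix.mulVec, dotProduct, gram, Matrix.of_apply]
  exact Finset.sum_congr rfl fun l _ => by rw [hK.symm (X i) (X l), mul_comm]

/-- In the eigenbasis both predictors are diagonal forms in the coordinates of `β` and `y`, with
coefficients `a k` and `satur (D k) t⁻¹`; the deterministic equivalent bounds their difference
uniformly in `k`. -/
theorem abs_avgRFPredictor_sub_krrPredictor_le (hK : IsKernel K) (hf : IsGaussianFeatures K π f)
    (hN : 0 < N) (hP : 0 < P) (hlam : 0 < lam) (y : Fin N → ℝ) (hG : (gram K X).PosDef)
    (ht : 0 < t)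
    (hteq : lam * t⁻¹ + 1 / (P : ℝ) * ∑ k, satur (hG.isHermitian.eigenvalues k) t⁻¹ = 1)
    (x : Pt d) :
    |avgRFPredictor π f X y lam x - krrPredictor K X y t x|
      ≤ equivConst lam (1 / (P : ℝ) * (gram K X).trace) / P * √(K x x) * invKernelNorm K X y := by
  obtain ⟨U, hU, hGU⟩ := exists_conj_diagonal hG.isHermitian
  set D := hG.isHermitian.eigenvalues with hDdef
  have hD : ∀ k, 0 < D k := hG.eigenvalues_pos
  have hP0 : (0 : ℝ) < P := by exact_mod_cast hP
  set β := (gram K X)⁻¹ *ᵥ fun i => K x (X i) with hβdef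
  have hβ : ∀ i, K x (X i) = (gram K X *ᵥ β) i := fun i => by rw [hβdef, gram_mulVec_inv hG]
  have hc : ∀ k, 0 ≤ D k / P := fun k => div_nonneg (hD k).le hP0.le
  have hPc : ∀ k, (P : ℝ) * (D k / P) = D k := fun k => mul_div_cancel₀ _ hP0.ne'
  have htr : (gram K X).trace = ∑ k, D k := by
    simpa using hG.isHermitian.trace_eq_sum_eigenvalues
  have htr0 : 0 ≤ (gram K X).trace := by
    rw [htr]; exact Finset.sum_nonneg fun k _ => (hD k).le
  let a : Fin N → ℝ := fun k => ∫ x : Fin N × Fin P → ℝ, D k / P *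
    (rows x k ⬝ᵥ resolvent lam (fun k => D k / P) x *ᵥ rows x k) ∂stdGaussianPi (Fin N × Fin P)
  have ha : ∀ k, |a k - satur (D k) t⁻¹| ≤ equivConst lam (1 / (P : ℝ) * (gram K X).trace) / P := by
    intro k
    have h := integral_quad_resolvent_sub_le hlam hP hc (inv_pos.2 ht)
      (by simpa only [hPc] using hteq) k
    simpa only [hPc, ← htr] using h
  have havg : avgRFPredictor π f X y lam x = ∑ k, (Uᵀ *ᵥ β) k * a k * (Uᵀ *ᵥ y) k := by
    rw [hf.avgRFPredictor_eq_sum hN hlam X y x β (regression_weights_eq hK hβ)]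
    simp only [hf.avgRFPredictor_data_eq hP hlam X y hU hD hGU, Finset.mul_sum]
    rw [Finset.sum_comm]
    refine Finset.sum_congr rfl fun k _ => ?_
    have hb : (Uᵀ *ᵥ β) k = ∑ i, U i k * β i := rfl
    rw [hb, Finset.sum_mul, Finset.sum_mul]
    exact Finset.sum_congr rfl fun i _ => by ring
  rw [havg, krrPredictor_eq_sum hU hD hGU y ht x β hβ, ← Finset.sum_sub_distrib]
  have hdiff : ∑ k, ((Uᵀ *ᵥ β) k * a k * (Uᵀ *ᵥ y) k
      - (Uᵀ *ᵥ β) k * satur (D k) t⁻¹ * (Uᵀ *ᵥ y) k)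
      = ∑ k, (Uᵀ *ᵥ β) k * (a k - satur (D k) t⁻¹) * (Uᵀ *ᵥ y) k :=
    Finset.sum_congr rfl fun k _ => by ring
  have hE : 0 ≤ equivConst lam (1 / (P : ℝ) * (gram K X).trace) / P :=
    div_nonneg (equivConst_pos hlam (by positivity)).le hP0.le
  have hquad : ∑ k, (Uᵀ *ᵥ β) k * D k * (Uᵀ *ᵥ β) k ≤ K x x := by
    rw [← dotProduct_conj_diagonal, ← hGU]
    exact hK.quad_le X x β hβ
  have hnorm : √(∑ k, (Uᵀ *ᵥ y) k * (D k)⁻¹ * (Uᵀ *ᵥ y) k) = invKernelNorm K X y := by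
    rw [invKernelNorm, hGU, inv_conj_diagonal hU hD, dotProduct_conj_diagonal]
  rw [hdiff, ← hnorm]
  refine (abs_sum_le_of_abs_le hD ha hE).trans ?_
  gcongr

theorem krrPredictor_memLp (hK : IsKernel K) {D : Measure (Pt d)}
    (hm : Measurable (Function.uncurry K)) (hint : Integrable (fun x => K x x) D)
    (y : Fin N → ℝ) : MemLp (krrPredictor K X y t) 2 D := by
  have h := memLp_finsetSum Finset.univ fun i _ => (hK.memLp_apply hm hint (X i)).mul_const
    (((gram K X + t • (1 : Matrix (Fin N) (Fin N) ℝ))⁻¹ *ᵥ y) i)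
  exact h

/-- The averaged predictor is a finite linear combination of the functions `K(·, x_l)`, so no joint
measurability of the features in `(x, ω)` is needed. -/
theorem avgRFPredictor_memLp (hK : IsKernel K) (hf : IsGaussianFeatures K π f)
    (hN : 0 < N) (hlam : 0 < lam) (y : Fin N → ℝ) (hG : (gram K X).PosDef) {D : Measure (Pt d)}
    (hm : Measurable (Function.uncurry K)) (hint : Integrable (fun x => K x x) D) :
    MemLp (avgRFPredictor π f X y lam) 2 D := by
  have he : avgRFPredictor π f X y lam = fun x => ∑ i, (∑ l, (gram K X)⁻¹ i l * K x (X l))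
      * avgRFPredictor π f X y lam (X i) := by
    ext x
    exact hf.avgRFPredictor_eq_sum hN hlam X y x ((gram K X)⁻¹ *ᵥ fun i => K x (X i))
      (regression_weights_eq hK fun i => by rw [gram_mulVec_inv hG])
  rw [he]
  have h := memLp_finsetSum Finset.univ fun i _ => (memLp_finsetSum Finset.univ fun l _ =>
    (hK.memLp_apply hm hint (X l)).const_mul ((gram K X)⁻¹ i l)).mul_const
      (avgRFPredictor π f X y lam (X i))
  exact h

end Comparison

end RandomFeatures

/-! ### The main theorem. -/

theorem corollary4p3 :
    ∃ c : ℝ → ℝ → ℝ → ℝ,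
      (∀ lam γ T : ℝ, 0 < lam → 0 < γ → 0 < T → 0 < c lam γ T) ∧
      ∀ (d N P : ℕ) (_ : 0 < N) (_ : 0 < P) (lam : ℝ) (_ : 0 < lam)
        (K : RandomFeatures.Pt d → RandomFeatures.Pt d → ℝ) (_ : RandomFeatures.IsKernel K)
        (X : Fin N → RandomFeatures.Pt d) (y : Fin N → ℝ)
        (hG : (RandomFeatures.gram K X).PosDef)
        (Ω : Type*) (_ : MeasurableSpace Ω) (π : Measure Ω) (_ : IsProbabilityMeasure π)
        (f : Fin P → RandomFeatures.Pt d → Ω → ℝ)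
        (_ : RandomFeatures.IsGaussianFeatures K π f)
        (γ T c₀ : ℝ) (_ : γ = (P : ℝ) / N)
        (_ : T = (1 / (N : ℝ)) * (RandomFeatures.gram K X).trace) (_ : c₀ = c lam γ T),
        ∃ lamt : ℝ,
          RandomFeatures.IsEffectiveRidge hG.isHermitian lam γ lamt ∧
          (∀ s : ℝ, RandomFeatures.IsEffectiveRidge hG.isHermitian lam γ s → s = lamt) ∧
          lam < lamt ∧
          -- `c₀` is the constant of the pointwise comparison of the two predictors
          (∀ x : RandomFeatures.Pt d,
            Integrable (fun ω => RandomFeatures.rfPredictor f X y lam ω x) π ∧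
            |RandomFeatures.avgRFPredictor π f X y lam x
                - RandomFeatures.krrPredictor K X y lamt x|
              ≤ c₀ * √(K x x) * RandomFeatures.invKernelNorm K X y / P) ∧
          -- the comparison of the two risks, with `C = c₀ √(𝔼_𝒟[K(x, x)])`
          ∀ (D : Measure (RandomFeatures.Pt d)) (_ : IsProbabilityMeasure D)
            (_ : Measurable (Function.uncurry K)) (_ : Integrable (fun x => K x x) D)
            (fstar : RandomFeatures.Pt d → ℝ) (_ : MemLp fstar 2 D)
            (C : ℝ) (_ : C = c₀ * √(∫ x, K x x ∂D)),
            Integrable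
              (fun x => (RandomFeatures.avgRFPredictor π f X y lam x - fstar x) ^ 2) D ∧
            Integrable
              (fun x => (RandomFeatures.krrPredictor K X y lamt x - fstar x) ^ 2) D ∧
            |RandomFeatures.risk D fstar (RandomFeatures.avgRFPredictor π f X y lam)
                - RandomFeatures.risk D fstar (RandomFeatures.krrPredictor K X y lamt)|
              ≤ C * RandomFeatures.invKernelNorm K X y / P *
                (2 * √(RandomFeatures.risk D fstar (RandomFeatures.krrPredictor K X y lamt))
                  + C * RandomFeatures.invKernelNorm K X y / P) := by
  -- The constant sees `γ` and `T` only through `T / γ = tr K(X, X) / P`, the number `s` of the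
  -- deterministic equivalent.
  refine ⟨fun lam γ T => RandomFeatures.equivConst lam (T / γ),
    fun lam γ T hlam hγ hT => RandomFeatures.equivConst_pos hlam (div_pos hT hγ).le, ?_⟩
  intro d N P hN hP lam hlam K hK X y hG Ω _ π _ f hf γ T c₀ hγ hT hc₀
  replace hc₀ : c₀ = RandomFeatures.equivConst lam (T / γ) := hc₀
  have hN0 : (0 : ℝ) < N := by exact_mod_cast hN
  have hP0 : (0 : ℝ) < P := by exact_mod_cast hP
  obtain ⟨t, hlt, hteq, huniq⟩ := RandomFeatures.exists_unique_effective (q := 1 / (P : ℝ)) hN hlam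
    (by positivity) hG.eigenvalues_pos
  have ht : 0 < t := hlam.trans hlt
  have hs : T / γ = 1 / (P : ℝ) * (RandomFeatures.gram K X).trace := by
    rw [hT, hγ]; field_simp
  have hc₀0 : 0 ≤ c₀ := by
    have htr : 0 ≤ (RandomFeatures.gram K X).trace := hG.posSemidef.trace_nonneg
    rw [hc₀]
    exact (RandomFeatures.equivConst_pos hlam (by rw [hs]; positivity)).le
  have hbound : ∀ x, |RandomFeatures.avgRFPredictor π f X y lam x
      - RandomFeatures.krrPredictor K X y t x|
      ≤ c₀ * √(K x x) * RandomFeatures.invKernelNorm K X y / P := fun x => by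
    refine (RandomFeatures.abs_avgRFPredictor_sub_krrPredictor_le hK hf hN hP hlam y hG ht hteq
      x).trans_eq ?_
    rw [hc₀, hs]; ring
  refine ⟨t, (RandomFeatures.isEffectiveRidge_iff hN hP hG.isHermitian hγ).2 ⟨ht, hteq⟩,
    fun s h => ?_, hlt, fun x => ⟨hf.integrable_rfPredictor hN hlam X y x, hbound x⟩, ?_⟩
  · obtain ⟨hs0, hs1⟩ := (RandomFeatures.isEffectiveRidge_iff hN hP hG.isHermitian hγ).1 h
    exact huniq s hs0 hs1
  intro D _ hm hint fstar hfs C hC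
  have havg := RandomFeatures.avgRFPredictor_memLp hK hf hN hlam y hG hm hint
  have hkrr := RandomFeatures.krrPredictor_memLp (X := X) (t := t) hK hm hint y
  refine ⟨(havg.sub hfs).integrable_sq, (hkrr.sub hfs).integrable_sq, ?_⟩
  have hY : 0 ≤ RandomFeatures.invKernelNorm K X y := Real.sqrt_nonneg _
  have hA : 0 ≤ C * RandomFeatures.invKernelNorm K X y / P := by rw [hC]; positivity
  have hδA : ∫ x, (RandomFeatures.avgRFPredictor π f X y lam x
      - RandomFeatures.krrPredictor K X y t x) ^ 2 ∂D
      ≤ (C * RandomFeatures.invKernelNorm K X y / P) ^ 2 := by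
    -- The squared pointwise bound is a constant times `K x x`; its integral produces the factor
    -- `𝔼_𝒟[K(x, x)]` in `C²`.
    have hpt : ∀ x, (RandomFeatures.avgRFPredictor π f X y lam x
        - RandomFeatures.krrPredictor K X y t x) ^ 2
        ≤ (c₀ * RandomFeatures.invKernelNorm K X y / P) ^ 2 * K x x := fun x => by
      rw [← sq_abs]
      refine (pow_le_pow_left₀ (abs_nonneg _) (hbound x) 2).trans_eq ?_
      have h := Real.sq_sqrt (hK.diag_nonneg x)
      calc _ = (c₀ * RandomFeatures.invKernelNorm K X y / P) ^ 2 * √(K x x) ^ 2 := by ring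
        _ = _ := by rw [h]
    have h := integral_mono (havg.sub hkrr).integrable_sq (hint.const_mul _) hpt
    rw [integral_const_mul] at h
    refine h.trans_eq ?_
    have h2 := Real.sq_sqrt (integral_nonneg (μ := D) hK.diag_nonneg)
    rw [hC]
    calc _ = (c₀ * RandomFeatures.invKernelNorm K X y / P) ^ 2 * √(∫ x, K x x ∂D) ^ 2 := by rw [h2]
      _ = _ := by ring
  -- Applied with `δ` the difference of the two predictors and `u` the error of kernel ridge
  -- regression, so that `δ + u` is the error of the averaged predictor.
  have h := RandomFeatures.abs_integral_sq_sub_le (havg.sub hkrr) (hkrr.sub hfs) hA hδA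
  simpa [RandomFeatures.risk] using h
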